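/- Let $0<s<1$ and $\varepsilon>0$, and write $$(-\Delta)^s u(y)=C_{s,1}\,\mathrm{P.V.}\!\int_{\mathbb R}\frac{u(y)-u(w)}{|y-w|^{1+2s}}\,dw,\qquad C_{s,1}=\frac{4^s\,\Gamma(1/2+s)}{\pi^{1/2}|\Gamma(-s)|},\qquad \mathcal L^s u=\partial_v(vu)-(-\Delta_v)^s u .$$ Let $\mathcal M>0$ be the equilibrium on $\mathbb R$: $\mathcal M\in C^2$, $\mathcal L^s\mathcal M=0$, $\int_{\mathbb R}\mathcal M\,dv=1$, and $\mathcal M(v)\sim C|v|^{-1-2s}$ as $|v|\to\infty$ for some $C>0$. Put $$I(a,b)(v)=C_{s,1}\int_{\mathbb R}\frac{(a(v)-a(w))(b(w)-b(v))}{|v-w|^{1+2s}}\,dw,\qquad H=L^2(\mathbb R^2,\mathcal M(v)^{-1}\,dv\,dx).$$ Given $f_{in}(x,v)$, let $\rho_{in}(x)=\int_{\mathbb R} f_{in}(x,v)\,dv$. Consider the rescaled Lévy–Fokker–Planck equation $$\varepsilon^{2s}\partial_t f+\varepsilon v\,\partial_x f=\mathcal L^s f,\qquad f(0,x,v)=f_{in}(x,v),\tag{1}$$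 and the split system $$\varepsilon^{2s}\partial_t g+\varepsilon v\,\partial_x g=\mathcal L^s g-I(\eta,\mathcal M),\qquad \partial_t\eta=-(-\Delta_x)^s\eta,\tag{2}$$ $$\eta(0,x,v)=\rho_{in}(x+\varepsilon v),\qquad g(0,x,v)=f_{in}(x,v)-\eta(0,x,v)\mathcal M(v).\tag{3}$$ Solutions are classical: the equations hold at every point $(t,x,v)$ with $t>0$. The unknowns $f$ and $g$ belong to $C([0,\infty);H)$ and for $t>0$ are $C^1$ in $(t,x,v)$ and $C^2$ in $(x,v)$; for each $v$, $\eta(\cdot,\cdot,v)$ belongs to $C([0,\infty);L^2(\mathbb R,dx))$ and for $t>0$ is $C^1$ in $(t,x)$ and $C^2$ in $x$; and $(-\Delta_v)^s f$, $(-\Delta_v)^s g$, $(-\Delta_x)^s\eta$ exist at every point with $t>0$ (the integrals over $\{|y-w|>\delta\}$ converge absolutely and have a limit as $\delta\downarrow0$). Then: 1. If $(\eta,g)$ solves (2) with initial data (3), then $f=\eta\mathcal M+g$ solves (1). 2. Both systems dissipate the energy: if $f$ solves (1), or if $f=\eta\mathcal M+g$ where $(\eta,g)$ solves (2) with initial data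 (3), and $$E_f(t)=\Big(\int_{\mathbb R}\int_{\mathbb R}\frac{f(t,x,v)^2}{\mathcal M(v)}\,dv\,dx\Big)^{1/2},$$ then $\frac{dE_f}{dt}\le 0$, in the following sense: $E_f$ is non-increasing on $[0,\infty)$; $E_f$ is differentiable with $\frac{dE_f}{dt}\le0$ at almost every $t>0$; and $E_f$ is differentiable with $\frac{dE_f}{dt}\le 0$ at every $t>0$ at which $t\mapsto f(t)\in H$ is differentiable. -/

import Mathlib

open Set Filter Topology MeasureTheory
open scoped ENNReal

noncomputable section

namespace LFP

/-- The normalizing constant `C_{s,1} = 4^s Γ(1/2 + s) / (π^{1/2} |Γ(-s)|)` in dimension one. -/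
def fracConst (s : ℝ) : ℝ :=
  (4 : ℝ) ^ s * Real.Gamma (1 / 2 + s) / (Real.pi ^ (1 / 2 : ℝ) * |Real.Gamma (-s)|)

/-- The integrand `(u(x) - u(y)) / |x - y|^{1+2s}` of the fractional Laplacian. -/
def fracKernel (s : ℝ) (u : ℝ → ℝ) (x y : ℝ) : ℝ :=
  (u x - u y) / |x - y| ^ (1 + 2 * s)

/-- The fractional Laplacian with the ball of radius `δ` around `x` cut out. -/
def truncFracLap (s : ℝ) (u : ℝ → ℝ) (x δ : ℝ) : ℝ :=
  fracConst s * ∫ y in {y : ℝ | δ < |x - y|}, fracKernel s u x y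

/-- `(-Δ)^s u (x)` exists and equals `L`: the truncated integrals converge absolutely, and they tend
to `L` as the truncation is removed (Cauchy principal value). -/
def HasFracLap (s : ℝ) (u : ℝ → ℝ) (x L : ℝ) : Prop :=
  (∀ δ : ℝ, 0 < δ → IntegrableOn (fracKernel s u x) {y : ℝ | δ < |x - y|}) ∧
    Tendsto (truncFracLap s u x) (𝓝[>] 0) (𝓝 L)

/-- The principal value `(-Δ)^s u (x)` is well defined. -/
def FracLapExists (s : ℝ) (u : ℝ → ℝ) (x : ℝ) : Prop :=
  ∃ L : ℝ, HasFracLap s u x L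

/-- `(-Δ)^s u (x)`; meaningful where `FracLapExists s u x`. -/
def fracLap (s : ℝ) (u : ℝ → ℝ) (x : ℝ) : ℝ :=
  limUnder (𝓝[>] (0 : ℝ)) (truncFracLap s u x)

theorem HasFracLap.fracLap_eq {s : ℝ} {u : ℝ → ℝ} {x L : ℝ} (h : HasFracLap s u x L) :
    fracLap s u x = L :=
  h.2.limUnder_eq

/-- The Lévy–Fokker–Planck operator `ℒ^s u = ∂_v (v u) - (-Δ_v)^s u`. -/
def levyFP (s : ℝ) (u : ℝ → ℝ) (v : ℝ) : ℝ :=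
  deriv (fun w => w * u w) v - fracLap s u v

/-- The remainder in the product rule for the fractional Laplacian,
`I(a,b)(v) = C_{s,1} ∫ (a(v) - a(w)) (b(w) - b(v)) / |v - w|^{1+2s} dw`. -/
def prodRem (s : ℝ) (a b : ℝ → ℝ) (v : ℝ) : ℝ :=
  fracConst s * ∫ w, (a v - a w) * (b w - b v) / |v - w| ^ (1 + 2 * s)

/-- `M` is the normalized equilibrium: a positive density of mass one with `ℒ^s M = 0`
and `M(v) ~ C / |v|^{1+2s}` as `|v| → ∞`. -/
structure IsEquilibrium (s : ℝ) (M : ℝ → ℝ) : Prop where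
  contDiff : ContDiff ℝ 2 M
  pos : ∀ v, 0 < M v
  integrable : Integrable M
  integral_eq_one : ∫ v, M v = 1
  fracLap_exists : ∀ v, FracLapExists s M v
  levyFP_eq_zero : ∀ v, levyFP s M v = 0
  tail : ∃ C : ℝ, 0 < C ∧ Tendsto (fun v => M v * |v| ^ (1 + 2 * s)) (cocompact ℝ) (𝓝 C)

/-- The measure `M(v)⁻¹ dv dx` on phase space. -/
def phaseMeasure (M : ℝ → ℝ) : Measure (ℝ × ℝ) :=
  volume.withDensity fun p => ENNReal.ofReal (M p.2)⁻¹

/-- `u ∈ C([0,∞); L²(μ))`. -/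
structure IsL2Curve {α : Type*} [MeasurableSpace α] (μ : Measure α) (u : ℝ → α → ℝ) : Prop where
  memLp : ∀ t, 0 ≤ t → MemLp (u t) 2 μ
  continuous : ∀ t, 0 ≤ t →
    Tendsto (fun r => eLpNorm (fun p => u r p - u t p) 2 μ) (𝓝[Ici 0] t) (𝓝 0)

/-- The `L²(μ)`-valued map `r ↦ u(r)` is differentiable at the time `t`. -/
def L2DifferentiableAt {α : Type*} [MeasurableSpace α] (μ : Measure α) (u : ℝ → α → ℝ) (t : ℝ) :
    Prop :=
  ∃ w : α → ℝ, MemLp w 2 μ ∧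
    Tendsto (fun r => eLpNorm (fun p => (u r p - u t p) / (r - t) - w p) 2 μ) (𝓝[≠] t) (𝓝 0)

/-- The regularity of a kinetic unknown `f(t,x,v)`: it lies in `C([0,∞); L²(M(v)⁻¹ dv dx))`, and for
`t > 0` it is `C¹` in `(t,x,v)`, `C²` in `(x,v)`, with `(-Δ_v)^s f` defined at every point. -/
structure IsRegular (s : ℝ) (M : ℝ → ℝ) (f : ℝ → ℝ → ℝ → ℝ) : Prop where
  curve : IsL2Curve (phaseMeasure M) (fun t (p : ℝ × ℝ) => f t p.1 p.2)
  contDiffOn : ContDiffOn ℝ 1 (fun q : ℝ × ℝ × ℝ => f q.1 q.2.1 q.2.2) (Ioi 0 ×ˢ univ)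
  contDiff : ∀ t, 0 < t → ContDiff ℝ 2 (fun p : ℝ × ℝ => f t p.1 p.2)
  fracLap_exists : ∀ t, 0 < t → ∀ x v, FracLapExists s (fun w => f t x w) v

/-- `f` solves `ε^{2s} ∂_t f + ε v ∂_x f = ℒ^s f`, `f(0) = f_in`. -/
structure IsLFPSolution (s ε : ℝ) (M : ℝ → ℝ) (f_in : ℝ → ℝ → ℝ) (f : ℝ → ℝ → ℝ → ℝ) : Prop where
  regular : IsRegular s M f
  equation : ∀ t, 0 < t → ∀ x v,
    ε ^ (2 * s) * deriv (fun r => f r x v) t + ε * v * deriv (fun y => f t y v) x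
      = levyFP s (fun w => f t x w) v
  initial : ∀ x v, f 0 x v = f_in x v

/-- The macroscopic density `ρ_in(x) = ∫ f_in(x,v) dv`. -/
def density (f_in : ℝ → ℝ → ℝ) (x : ℝ) : ℝ := ∫ v, f_in x v

/-- `(η, g)` solves the split system
`ε^{2s} ∂_t g + ε v ∂_x g = ℒ^s g - I(η, M)`, `∂_t η = -(-Δ_x)^s η`, with
`η(0,x,v) = ρ_in(x + εv)` and `g(0,x,v) = f_in(x,v) - η(0,x,v) M(v)`.
The velocity `v` is only a parameter in the equation for `η`, whose solution lies in
`C([0,∞); L²(dx))` for each `v`, and for `t > 0` is `C¹` in `(t,x)` and `C²` in `x`. -/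
structure IsSplitSolution (s ε : ℝ) (M : ℝ → ℝ) (f_in : ℝ → ℝ → ℝ) (η g : ℝ → ℝ → ℝ → ℝ) :
    Prop where
  g_regular : IsRegular s M g
  g_equation : ∀ t, 0 < t → ∀ x v,
    ε ^ (2 * s) * deriv (fun r => g r x v) t + ε * v * deriv (fun y => g t y v) x
      = levyFP s (fun w => g t x w) v - prodRem s (fun w => η t x w) M v
  g_initial : ∀ x v, g 0 x v = f_in x v - η 0 x v * M v
  η_curve : ∀ v, IsL2Curve volume (fun t x => η t x v)
  η_contDiffOn : ∀ v, ContDiffOn ℝ 1 (fun q : ℝ × ℝ => η q.1 q.2 v) (Ioi 0 ×ˢ univ)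
  η_contDiff : ∀ t, 0 < t → ∀ v, ContDiff ℝ 2 (fun x => η t x v)
  η_fracLap_exists : ∀ t, 0 < t → ∀ x v, FracLapExists s (fun y => η t y v) x
  η_equation : ∀ t, 0 < t → ∀ x v,
    deriv (fun r => η r x v) t = -fracLap s (fun y => η t y v) x
  η_initial : ∀ x v, η 0 x v = density f_in (x + ε * v)

/-- The total energy `E_f(t) = (∬ f(t,x,v)² / M(v) dv dx)^{1/2}`. -/
def energy (M : ℝ → ℝ) (f : ℝ → ℝ → ℝ → ℝ) (t : ℝ) : ℝ :=
  √(∫ x, ∫ v, f t x v ^ 2 / M v)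

/-- The energy dissipation `dE_f/dt ≤ 0`: the energy does not increase on `[0,∞)`; it has a
derivative, which is `≤ 0`, at almost every `t > 0`, and in fact at every `t > 0` at which `f` is
differentiable as a function of time with values in `L²(M(v)⁻¹ dv dx)`. -/
structure EnergyDissipates (M : ℝ → ℝ) (f : ℝ → ℝ → ℝ → ℝ) : Prop where
  antitone : AntitoneOn (energy M f) (Ici 0)
  ae_deriv_nonpos : ∀ᵐ t : ℝ, 0 < t →
    DifferentiableAt ℝ (energy M f) t ∧ deriv (energy M f) t ≤ 0
  deriv_nonpos : ∀ t, 0 < t →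
    L2DifferentiableAt (phaseMeasure M) (fun r (p : ℝ × ℝ) => f r p.1 p.2) t →
      DifferentiableAt ℝ (energy M f) t ∧ deriv (energy M f) t ≤ 0

end LFP

end

/-!
A solution `f` of the kinetic equation is only known to be classical for positive times and
continuous in the weighted `L²` space, so the energy cannot be differentiated directly. The way
around this is a pointwise inequality. With `h = f / M` and `F = f² / M = M h²`, the truncated
fractional Laplacians `A_δ` satisfy

  `2 h A_δ f = A_δ F + h² A_δ M + C ∫_{|v-w|>δ} M(w) (h(w) - h(v))² |v-w|^{-1-2s} dw`

(`truncFracLap_sq_div_le`), and since `ℒ^s M = 0` the zeroth-order terms cancel those of the drift.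
Hence `F`, which is merely integrable, is a subsolution of the kinetic equation. It is tested
against cutoffs `α(x) β(v)` tending to `1` (`IsCutoff`). The operators are moved to the cutoffs, where
they are uniformly small: `β` is a bump function of `log(1 + v²) / R`, which makes `v β'(v)` and the
truncated fractional Laplacians of `β` tend to `0` uniformly (`exists_isCutoff`), and `α` varies so
slowly that the transport term is small on the support of `β` (`integral_phase_cutoff_le`). So the
tested energy grows at a rate of at most a small multiple of `∬ F`, and in the limit the energy does
not grow (`integral_le_of_tested_deriv_le`).

The same argument with weight `1` and no drift shows that classical solutions of the fractional heat
equation in `C([0,∞); L²)` are unique (`eq_zero_of_fractional_heat`). As `v` is a parameter in the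
equation for `η`, the form `ρ_in(x + εv)` of the initial data propagates: `η(t,x,v) = η(t,x+εv,0)`.
Therefore `ε v ∂_x η = v ∂_v η` and `ε^{2s} (-Δ_x)^s η = (-Δ_v)^s η`, and the product rule for the
fractional Laplacian, whose remainder is `I(η, M)`, turns the split system into the kinetic
equation for `η M + g`.
-/

open Set Filter Topology MeasureTheory
open scoped ENNReal

namespace LFP

/-! ### The truncated kernel -/

theorem fracConst_nonneg {s : ℝ} (hs0 : 0 < s) : 0 ≤ fracConst s := by
  have h1 : 0 < Real.Gamma (1 / 2 + s) := Real.Gamma_pos_of_pos (by linarith)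
  unfold fracConst
  positivity

/-- The convolution kernel `|z|^{-1-2s}` of the fractional Laplacian, set to zero for `|z| ≤ δ`. -/
noncomputable def cutKernel (s δ z : ℝ) : ℝ :=
  {z : ℝ | δ < |z|}.indicator (fun z => (|z| ^ (1 + 2 * s))⁻¹) z

theorem measurableSet_lt_abs (δ : ℝ) : MeasurableSet {z : ℝ | δ < |z|} :=
  measurableSet_lt measurable_const continuous_abs.measurable

theorem cutKernel_nonneg (s δ z : ℝ) : 0 ≤ cutKernel s δ z :=
  indicator_nonneg (fun z _ => by positivity) z

theorem cutKernel_neg (s δ z : ℝ) : cutKernel s δ (-z) = cutKernel s δ z := by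
  simp [cutKernel, indicator]

theorem cutKernel_sub_comm (s δ x y : ℝ) : cutKernel s δ (x - y) = cutKernel s δ (y - x) := by
  rw [← cutKernel_neg, neg_sub]

theorem cutKernel_le (s δ z : ℝ) : cutKernel s δ z ≤ (|z| ^ (1 + 2 * s))⁻¹ := by
  unfold cutKernel
  by_cases h : z ∈ {z : ℝ | δ < |z|}
  · rw [indicator_of_mem h]
  · rw [indicator_of_notMem h]; positivity

theorem measurable_cutKernel (s δ : ℝ) : Measurable (cutKernel s δ) := by
  unfold cutKernel
  refine Measurable.indicator ?_ (measurableSet_lt_abs δ)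
  fun_prop

theorem integrable_of_even {g : ℝ → ℝ} (hg : ∀ z, g (-z) = g z)
    (h : IntegrableOn g (Ioi 0)) : Integrable g := by
  have h2 : IntegrableOn g (Iio 0) := by
    have := IntegrableOn.comp_neg_Iio (c := (0 : ℝ)) (f := g) (by simpa using h)
    simpa [hg] using this
  have h3 : IntegrableOn g (Iic 0) := (integrableOn_Iic_iff_integrableOn_Iio (by simp)).2 h2
  rw [← integrableOn_univ, ← Iic_union_Ioi (a := (0 : ℝ))]
  exact h3.union h

theorem integrable_abs_rpow_far {p δ : ℝ} (hp : p < -1) (hδ : 0 < δ) :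
    Integrable ({z : ℝ | δ < |z|}.indicator (fun z => |z| ^ p)) := by
  refine integrable_of_even (fun z => by simp [indicator]) ?_
  have h := (integrableOn_Ioi_rpow_of_lt hp hδ)
  rw [← integrable_indicator_iff measurableSet_Ioi] at h ⊢
  convert h using 1
  ext z
  by_cases hz : 0 < z
  · simp [indicator, hz, abs_of_pos hz]
  · have : ¬ δ < z := by linarith
    simp [indicator, hz, this]

theorem integrable_abs_rpow_near {p : ℝ} (hp : -1 < p) :
    Integrable ({z : ℝ | |z| ≤ 1}.indicator (fun z => |z| ^ p)) := by
  refine integrable_of_even (fun z => by simp [indicator]) ?_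
  have h := (intervalIntegral.intervalIntegrable_rpow' (a := 0) (b := 1) hp).1
  rw [← integrable_indicator_iff measurableSet_Ioi]
  rw [← integrable_indicator_iff measurableSet_Ioc] at h
  refine h.congr (.of_forall fun z => ?_)
  by_cases hz : 0 < z
  · simp [indicator, hz, abs_of_pos hz]
  · simp [indicator, hz]

theorem integrable_cutKernel {s δ : ℝ} (hs0 : 0 < s) (hδ : 0 < δ) :
    Integrable (cutKernel s δ) := by
  have h := integrable_abs_rpow_far (p := -(1 + 2 * s)) (by linarith) hδ
  convert h using 1
  ext z
  simp only [cutKernel, indicator]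
  split_ifs
  · rw [Real.rpow_neg (abs_nonneg z)]
  · rfl

/-- A weight that is at most quadratic near the origin and grows at most like `|z|^s` at infinity
is integrable against the kernel `|z|^{-1-2s}`. -/
theorem integrable_mul_kernel_of_le {s D N : ℝ} (hs0 : 0 < s) (hs1 : s < 1) {q : ℝ → ℝ}
    (hq : AEStronglyMeasurable q) (hnear : ∀ z, |z| ≤ 1 → |q z| ≤ D * z ^ 2)
    (hfar : ∀ z, 1 < |z| → |q z| ≤ N * |z| ^ s) :
    Integrable fun z => q z * (|z| ^ (1 + 2 * s))⁻¹ := by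
  have h1 := (integrable_abs_rpow_near (p := 1 - 2 * s) (by linarith)).const_mul D
  have h2 := (integrable_abs_rpow_far (p := -(1 + s)) (δ := 1) (by linarith) one_pos).const_mul N
  have hk : Measurable fun z : ℝ => (|z| ^ (1 + 2 * s))⁻¹ := by fun_prop
  refine (h1.add h2).mono' (hq.mul hk.aestronglyMeasurable) ?_
  filter_upwards [compl_mem_ae_iff.2 (measure_singleton (0 : ℝ))] with z hz
  have hz0 : 0 < |z| := abs_pos.2 hz
  have hkz : 0 ≤ (|z| ^ (1 + 2 * s))⁻¹ := by positivity
  rw [Real.norm_eq_abs, abs_mul, abs_of_nonneg hkz]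
  simp only [Pi.add_apply, indicator, mem_ofPred_eq]
  by_cases h : |z| ≤ 1
  · simp only [h, not_lt.2 h, if_true, if_false, mul_zero, add_zero]
    refine (mul_le_mul_of_nonneg_right (hnear z h) hkz).trans_eq ?_
    rw [← sq_abs z, ← Real.rpow_natCast, mul_assoc, ← Real.rpow_neg hz0.le, ← Real.rpow_add hz0]
    congr 2; push_cast; ring
  · simp only [h, not_le.1 h, if_true, if_false, mul_zero, zero_add]
    refine (mul_le_mul_of_nonneg_right (hfar z (not_le.1 h)) hkz).trans_eq ?_
    rw [mul_assoc, ← Real.rpow_neg hz0.le, ← Real.rpow_add hz0]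
    congr 2; ring

/-! ### Truncated fractional Laplacians -/

theorem measurableSet_far (x δ : ℝ) : MeasurableSet {y : ℝ | δ < |x - y|} :=
  measurableSet_lt measurable_const (by fun_prop)

theorem indicator_fracKernel (s : ℝ) (u : ℝ → ℝ) (x δ : ℝ) :
    {y : ℝ | δ < |x - y|}.indicator (fracKernel s u x)
      = fun y => (u x - u y) * cutKernel s δ (x - y) := by
  ext y
  simp only [indicator, fracKernel, cutKernel, mem_ofPred_eq]
  split_ifs
  · rw [div_eq_mul_inv]
  · simp

theorem integrableOn_fracKernel_iff {s : ℝ} {u : ℝ → ℝ} {x δ : ℝ} :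
    IntegrableOn (fracKernel s u x) {y : ℝ | δ < |x - y|} ↔
      Integrable fun y => (u x - u y) * cutKernel s δ (x - y) := by
  rw [← integrable_indicator_iff (measurableSet_far x δ), indicator_fracKernel]

theorem truncFracLap_eq (s : ℝ) (u : ℝ → ℝ) (x δ : ℝ) :
    truncFracLap s u x δ = fracConst s * ∫ y, (u x - u y) * cutKernel s δ (x - y) := by
  rw [truncFracLap, ← integral_indicator (measurableSet_far x δ), indicator_fracKernel]

/-- The truncated fractional Laplacian is controlled by a majorant of the second differences:
the kernel is even, so the first-order term cancels. -/
theorem abs_truncFracLap_le {s : ℝ} (hs0 : 0 < s) {u Q : ℝ → ℝ} {v δ : ℝ}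
    (hint : IntegrableOn (fracKernel s u v) {y : ℝ | δ < |v - y|})
    (hQ : ∀ z, |2 * u v - u (v + z) - u (v - z)| * (|z| ^ (1 + 2 * s))⁻¹ ≤ Q z)
    (hQi : Integrable Q) :
    |truncFracLap s u v δ| ≤ fracConst s * ∫ z, Q z := by
  have hC := fracConst_nonneg hs0
  rw [integrableOn_fracKernel_iff] at hint
  rw [truncFracLap_eq, abs_mul, abs_of_nonneg hC]
  refine mul_le_mul_of_nonneg_left ?_ hC
  have i1 : Integrable fun z => (u v - u (v - z)) * cutKernel s δ z := by
    simpa using hint.comp_sub_left v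
  have i2 : Integrable fun z => (u v - u (v + z)) * cutKernel s δ z := by
    simpa [cutKernel_neg] using i1.comp_neg
  have e1 : ∫ y, (u v - u y) * cutKernel s δ (v - y) = ∫ z, (u v - u (v - z)) * cutKernel s δ z := by
    rw [← integral_sub_left_eq_self _ volume v]; simp
  have e2 : ∫ z, (u v - u (v - z)) * cutKernel s δ z
      = ∫ z, (u v - u (v + z)) * cutKernel s δ z := by
    rw [← integral_neg_eq_self]; simp [cutKernel_neg]
  have e3 : 2 * ∫ y, (u v - u y) * cutKernel s δ (v - y)
      = ∫ z, (2 * u v - u (v + z) - u (v - z)) * cutKernel s δ z := by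
    rw [two_mul]
    nth_rewrite 2 [e1]
    rw [e1, e2]
    nth_rewrite 1 [← e2]
    rw [← integral_add i1 i2]
    congr 1; ext z; ring
  have e4 : |∫ z, (2 * u v - u (v + z) - u (v - z)) * cutKernel s δ z|
      ≤ ∫ z, Q z := by
    rw [← Real.norm_eq_abs]
    refine norm_integral_le_of_norm_le hQi (.of_forall fun z => ?_)
    rw [Real.norm_eq_abs, abs_mul, abs_of_nonneg (cutKernel_nonneg s δ z)]
    exact (mul_le_mul_of_nonneg_left (cutKernel_le s δ z) (abs_nonneg _)).trans (hQ z)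
  rw [← e3, abs_mul, abs_two] at e4
  linarith [abs_nonneg (∫ y, (u v - u y) * cutKernel s δ (v - y))]

/-- The kernel is symmetric, so the truncated fractional Laplacian is symmetric in `L²`. -/
theorem integral_mul_truncFracLap {s δ : ℝ} (hs0 : 0 < s) (hδ : 0 < δ) {F φ : ℝ → ℝ} {B : ℝ}
    (hF : Integrable F) (hφ : AEStronglyMeasurable φ) (hB : ∀ v, |φ v| ≤ B) :
    ∫ v, φ v * truncFracLap s F v δ = ∫ v, F v * truncFracLap s φ v δ := by
  have hκ := integrable_cutKernel hs0 hδ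
  have hφB : ∀ v, ‖φ v‖ ≤ B := hB
  -- the two products that appear, as functions on the plane
  have j1 : Integrable (fun p : ℝ × ℝ => φ p.1 * F p.1 * cutKernel s δ (p.1 - p.2))
      (volume.prod volume) := by
    have h := (hF.bdd_mul hφ (.of_forall hφB)).convolution_integrand
      (ContinuousLinearMap.mul ℝ ℝ) hκ
    have h2 := h.swap
    refine h2.congr (.of_forall fun p => ?_)
    simp [Function.comp, cutKernel_sub_comm s δ p.2 p.1]
  have j2 : Integrable (fun p : ℝ × ℝ => φ p.1 * F p.2 * cutKernel s δ (p.1 - p.2))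
      (volume.prod volume) := by
    have h := hF.convolution_integrand (ContinuousLinearMap.mul ℝ ℝ) hκ
    have h2 := h.bdd_mul (hφ.comp_fst (ν := volume)) (.of_forall fun p => hφB p.1)
    refine h2.congr (.of_forall fun p => ?_)
    simp [mul_assoc]
  have L : ∫ v, φ v * truncFracLap s F v δ = fracConst s *
      ((∫ p, φ p.1 * F p.1 * cutKernel s δ (p.1 - p.2) ∂volume.prod volume)
        - ∫ p, φ p.1 * F p.2 * cutKernel s δ (p.1 - p.2) ∂volume.prod volume) := by
    rw [← integral_sub j1 j2, integral_prod (fun p : ℝ × ℝ => φ p.1 * F p.1 * cutKernel s δ (p.1 - p.2)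
        - φ p.1 * F p.2 * cutKernel s δ (p.1 - p.2)) (j1.sub j2), ← integral_const_mul]
    congr 1; ext v
    rw [truncFracLap_eq, mul_left_comm, ← integral_const_mul]
    congr 2; ext w; ring
  have j2s : Integrable (fun p : ℝ × ℝ => F p.1 * φ p.2 * cutKernel s δ (p.1 - p.2))
      (volume.prod volume) := by
    refine j2.swap.congr (.of_forall fun p => ?_)
    simp [Function.comp, cutKernel_sub_comm s δ p.2 p.1, mul_comm (F p.1)]
  have e2 : ∫ p, φ p.1 * F p.2 * cutKernel s δ (p.1 - p.2) ∂volume.prod volume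
      = ∫ p, F p.1 * φ p.2 * cutKernel s δ (p.1 - p.2) ∂volume.prod volume := by
    rw [← integral_prod_swap]
    congr 1; ext p
    simp [cutKernel_sub_comm s δ p.2 p.1, mul_comm (F p.1)]
  rw [L, e2, ← integral_sub j1 j2s, integral_prod (fun p : ℝ × ℝ =>
    φ p.1 * F p.1 * cutKernel s δ (p.1 - p.2) - F p.1 * φ p.2 * cutKernel s δ (p.1 - p.2))
    (j1.sub j2s), ← integral_const_mul]
  refine integral_congr_ae (.of_forall fun v => ?_)
  symm
  simp only
  rw [truncFracLap_eq, mul_left_comm, ← integral_const_mul]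
  congr 2; ext w; ring

/-- The convexity inequality behind the dissipation. With `h = u / M`, the difference of the two
sides is `C ∫_{|v-w|>δ} M(w) (h(w) - h(v))² |v-w|^{-1-2s} dw`. -/
theorem truncFracLap_sq_div_le {s δ v : ℝ} (hs0 : 0 < s) {u M : ℝ → ℝ}
    (hM : ∀ w, 0 < M w)
    (iu : IntegrableOn (fracKernel s u v) {y : ℝ | δ < |v - y|})
    (iM : IntegrableOn (fracKernel s M v) {y : ℝ | δ < |v - y|})
    (iF : IntegrableOn (fracKernel s (fun w => u w ^ 2 / M w) v) {y : ℝ | δ < |v - y|}) :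
    truncFracLap s (fun w => u w ^ 2 / M w) v δ + (u v / M v) ^ 2 * truncFracLap s M v δ
      ≤ 2 * (u v / M v) * truncFracLap s u v δ := by
  rw [integrableOn_fracKernel_iff] at iu iM iF
  rw [← sub_nonneg, truncFracLap_eq, truncFracLap_eq, truncFracLap_eq]
  have e : 2 * (u v / M v) * (fracConst s * ∫ y, (u v - u y) * cutKernel s δ (v - y))
      - (fracConst s * (∫ y, (u v ^ 2 / M v - u y ^ 2 / M y) * cutKernel s δ (v - y))
        + (u v / M v) ^ 2 * (fracConst s * ∫ y, (M v - M y) * cutKernel s δ (v - y)))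
      = fracConst s * ∫ y, M y * (u y / M y - u v / M v) ^ 2 * cutKernel s δ (v - y) := by
    have h : ∀ a b c : ℝ, 2 * (u v / M v) * (fracConst s * a) - (fracConst s * b
        + (u v / M v) ^ 2 * (fracConst s * c))
        = fracConst s * (2 * (u v / M v) * a - b - (u v / M v) ^ 2 * c) := by intros; ring
    have i1 : Integrable fun y => 2 * (u v / M v) * ((u v - u y) * cutKernel s δ (v - y))
        - (u v ^ 2 / M v - u y ^ 2 / M y) * cutKernel s δ (v - y) := (iu.const_mul _).sub iF
    rw [h, ← integral_const_mul, ← integral_const_mul,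
      ← integral_sub (iu.const_mul _) iF, ← integral_sub i1 (iM.const_mul _)]
    congr 2; ext y
    have h1 := (hM v).ne'
    have h2 := (hM y).ne'
    field_simp
    ring
  rw [e]
  refine mul_nonneg (fracConst_nonneg hs0) (integral_nonneg fun y => ?_)
  exact mul_nonneg (mul_nonneg (hM y).le (sq_nonneg _)) (cutKernel_nonneg s δ _)

/-! ### Uniform bounds and the weak convexity inequality -/

theorem abs_second_difference_le {u : ℝ → ℝ} (hu : ContDiff ℝ 2 u) {v z D : ℝ}
    (hD : ∀ y, |y - v| ≤ |z| → |deriv (deriv u) y| ≤ D) :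
    |2 * u v - u (v + z) - u (v - z)| ≤ 2 * D * z ^ 2 := by
  have hu1 : Differentiable ℝ u := hu.differentiable (by norm_num)
  have hu2 : Differentiable ℝ (deriv u) :=
    ((contDiff_succ_iff_deriv (n := 1)).1 hu).2.2.differentiable (by norm_num)
  have hD0 : 0 ≤ D := (abs_nonneg _).trans (hD v (by simp))
  -- the first derivative is Lipschitz on the interval
  have h1 : ∀ y, |y| ≤ |z| → |deriv u (v + y) - deriv u (v - y)| ≤ 2 * D * |z| := by
    intro y hy
    have := (convex_closedBall v |z|).norm_image_sub_le_of_norm_deriv_le (f := deriv u) (C := D)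
      (fun x _ => hu2 x) (fun x hx => hD x (by simpa [Real.dist_eq] using hx)) (x := v - y) (y := v + y)
      (by simpa using hy) (by simpa using hy)
    rw [Real.norm_eq_abs, Real.norm_eq_abs] at this
    refine this.trans ?_
    have e : v + y - (v - y) = 2 * y := by ring
    rw [e, abs_mul, abs_two]
    nlinarith
  have hd : ∀ x, HasDerivAt (fun y => 2 * u v - u (v + y) - u (v - y))
      (-(deriv u (v + x) - deriv u (v - x))) x := by
    intro x
    have a := (hu1 (v + x)).hasDerivAt.comp_const_add v x
    have b := (hu1 (v - x)).hasDerivAt.comp_const_sub v x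
    refine ((a.const_sub (2 * u v)).sub b).congr_deriv ?_
    ring
  have := (convex_closedBall (0 : ℝ) |z|).norm_image_sub_le_of_norm_hasDerivWithin_le
    (fun x _ => (hd x).hasDerivWithinAt) (C := 2 * D * |z|)
    (fun x hx => by rw [norm_neg]; exact h1 x (by simpa using hx)) (x := 0) (y := z) (by simp) (by simp)
  simp only [add_zero, sub_zero, Real.norm_eq_abs] at this
  have e : 2 * u v - u v - u v = 0 := by ring
  rw [e, sub_zero, mul_assoc, abs_mul_abs_self] at this
  linarith [sq z]

theorem cutKernel_le_const {s δ : ℝ} (hs0 : 0 < s) (hδ : 0 < δ) (z : ℝ) :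
    cutKernel s δ z ≤ (δ ^ (1 + 2 * s))⁻¹ := by
  unfold cutKernel indicator
  split_ifs with h
  · have h' : δ < |z| := h
    exact inv_anti₀ (by positivity) (Real.rpow_le_rpow hδ.le h'.le (by linarith))
  · positivity

theorem integrableOn_fracKernel_of_le {s δ B : ℝ} (hs0 : 0 < s) (hδ : 0 < δ) {u F : ℝ → ℝ}
    (hu : Continuous u) (hF : Integrable F) (hle : ∀ w, |u w| ≤ F w + B) (v : ℝ) :
    IntegrableOn (fracKernel s u v) {y : ℝ | δ < |v - y|} := by
  rw [integrableOn_fracKernel_iff]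
  have hκ := (integrable_cutKernel hs0 hδ).comp_sub_left v
  have h1 : Integrable fun y => u y * cutKernel s δ (v - y) := by
    refine ((hF.const_mul (δ ^ (1 + 2 * s))⁻¹).norm.add (hκ.const_mul B)).mono'
      (hu.aestronglyMeasurable.mul hκ.aestronglyMeasurable) (.of_forall fun y => ?_)
    have hk := cutKernel_nonneg s δ (v - y)
    rw [Real.norm_eq_abs, abs_mul, abs_of_nonneg hk]
    refine (mul_le_mul_of_nonneg_right (hle y) hk).trans ?_
    rw [add_mul]
    refine add_le_add ?_ (by simp)
    beta_reduce
    rw [norm_mul, Real.norm_eq_abs, Real.norm_eq_abs, abs_of_nonneg (by positivity), mul_comm]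
    calc cutKernel s δ (v - y) * F y ≤ cutKernel s δ (v - y) * |F y| := by
          gcongr; exact le_abs_self _
      _ ≤ _ := by gcongr; exact cutKernel_le_const hs0 hδ _
  refine ((hκ.const_mul (u v)).sub h1).congr (.of_forall fun y => ?_)
  simp only [Pi.sub_apply]; ring

/-- For a `C²` function that is the sum of an integrable and a bounded function, the truncated
fractional Laplacians are bounded on bounded sets, uniformly in the truncation. -/
theorem exists_abs_truncFracLap_le {s B : ℝ} (hs0 : 0 < s) (hs1 : s < 1) {u F : ℝ → ℝ}
    (hu : ContDiff ℝ 2 u) (hF : Integrable F) (hF0 : ∀ w, 0 ≤ F w)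
    (hle : ∀ w, |u w| ≤ F w + B) (K : ℝ) :
    ∃ N : ℝ, ∀ v, |v| ≤ K → ∀ δ, 0 < δ → |truncFracLap s u v δ| ≤ N := by
  have hc2 : Continuous (deriv (deriv u)) :=
    ((contDiff_succ_iff_deriv (n := 1)).1 hu).2.2.continuous_deriv (by norm_num)
  have bdd : ∀ g : ℝ → ℝ, Continuous g → ∀ L : ℝ, ∃ D, ∀ y, |y| ≤ L → |g y| ≤ D := by
    intro g hg L
    obtain ⟨D, hD⟩ := (isCompact_closedBall (0 : ℝ) L).exists_bound_of_continuousOn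
      hg.continuousOn
    exact ⟨D, fun y hy => hD y (by simpa [Real.dist_eq] using hy)⟩
  obtain ⟨D, hD⟩ := bdd _ hc2 (K + 1)
  obtain ⟨A, hA⟩ := bdd _ hu.continuous K
  set N : ℝ := 2 * |A| + 2 * |B|
  set q : ℝ → ℝ := fun z => if |z| ≤ 1 then 2 * |D| * z ^ 2 else N with hq
  have hqm : Measurable q := Measurable.ite
    (measurableSet_le continuous_abs.measurable measurable_const) (by fun_prop) (by fun_prop)
  have hqi : Integrable fun z => q z * (|z| ^ (1 + 2 * s))⁻¹ := by
    refine integrable_mul_kernel_of_le (D := 2 * |D|) (N := N) hs0 hs1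
      hqm.aestronglyMeasurable ?_ ?_
    · intro z hz
      simp only [hq, hz, if_true]
      rw [abs_of_nonneg (by positivity)]
    · intro z hz
      have hN : 0 ≤ N := by positivity
      simp only [hq, not_le.2 hz, if_false]
      rw [abs_of_nonneg hN]
      exact le_mul_of_one_le_right hN (Real.one_le_rpow hz.le hs0.le)
  refine ⟨fracConst s * ((∫ z, q z * (|z| ^ (1 + 2 * s))⁻¹) + 2 * ∫ w, F w), fun v hv δ hδ => ?_⟩
  have f1 : Integrable fun z => F (v + z) := hF.comp_add_left v
  have f2 : Integrable fun z => F (v - z) := hF.comp_sub_left v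
  have h := abs_truncFracLap_le hs0 (integrableOn_fracKernel_of_le hs0 hδ hu.continuous hF hle v)
    (Q := fun z => q z * (|z| ^ (1 + 2 * s))⁻¹ + (F (v + z) + F (v - z))) ?_ (hqi.add (f1.add f2))
  · refine h.trans_eq ?_
    have f12 : Integrable fun z => F (v + z) + F (v - z) := f1.add f2
    rw [integral_add hqi f12, integral_add f1 f2, integral_add_left_eq_self,
      integral_sub_left_eq_self]
    ring
  · intro z
    have hk : 0 ≤ (|z| ^ (1 + 2 * s))⁻¹ := by positivity
    by_cases hz : |z| ≤ 1
    · have h2 : |2 * u v - u (v + z) - u (v - z)| ≤ q z := by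
        simp only [hq, hz, if_true]
        refine abs_second_difference_le hu fun y hy => (hD y ?_).trans (le_abs_self D)
        have := abs_add_le (y - v) v
        rw [sub_add_cancel] at this
        linarith
      have := mul_le_mul_of_nonneg_right h2 hk
      linarith [hF0 (v + z), hF0 (v - z)]
    · have h2 : |2 * u v - u (v + z) - u (v - z)| ≤ q z + (F (v + z) + F (v - z)) := by
        simp only [hq, hz, if_false, N]
        have t1 := abs_sub (2 * u v - u (v + z)) (u (v - z))
        have t2 := abs_sub (2 * u v) (u (v + z))
        rw [abs_mul, abs_two] at t2
        linarith [hA v hv, le_abs_self A, le_abs_self B, hle (v + z), hle (v - z)]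
      have hk1 : (|z| ^ (1 + 2 * s))⁻¹ ≤ 1 :=
        inv_le_one_of_one_le₀ (Real.one_le_rpow (not_le.1 hz).le (by linarith))
      refine (mul_le_mul_of_nonneg_right h2 hk).trans ?_
      rw [add_mul]
      exact add_le_add le_rfl (mul_le_of_le_one_right (add_nonneg (hF0 _) (hF0 _)) hk1)

theorem stronglyMeasurable_truncFracLap (s δ : ℝ) {u : ℝ → ℝ} (hu : Measurable u) :
    StronglyMeasurable fun v => truncFracLap s u v δ := by
  simp only [truncFracLap_eq]
  refine StronglyMeasurable.const_mul ?_ _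
  refine StronglyMeasurable.integral_prod_right
    (f := fun v y => (u v - u y) * cutKernel s δ (v - y)) (Measurable.stronglyMeasurable ?_)
  have := measurable_cutKernel s δ
  unfold Function.uncurry
  fun_prop

theorem FracLapExists.hasFracLap {s : ℝ} {u : ℝ → ℝ} {x : ℝ} (h : FracLapExists s u x) :
    HasFracLap s u x (fracLap s u x) := by
  obtain ⟨L, hL⟩ := h
  rwa [hL.fracLap_eq]

/-- The weak form of the pointwise convexity inequality
`(-Δ)^s(u²/M) + (u/M)² (-Δ)^s M ≤ 2 (u/M) (-Δ)^s u`, tested against a cutoff `φ` whose truncated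
fractional Laplacians are at most `c`. -/
theorem integral_cutoff_fracLap_le {s B c : ℝ} (hs0 : 0 < s) (hs1 : s < 1) {u M φ : ℝ → ℝ}
    (hM : ContDiff ℝ 2 M) (hMpos : ∀ w, 0 < M w) (hMB : ∀ w, M w ≤ B)
    (hML : ∀ v, FracLapExists s M v)
    (hu : ContDiff ℝ 2 u) (huL : ∀ v, FracLapExists s u v)
    (hF : Integrable fun w => u w ^ 2 / M w)
    (hφ : Continuous φ) (hφc : HasCompactSupport φ) (hφ0 : ∀ v, 0 ≤ φ v)
    (hφB : ∀ δ, 0 < δ → ∀ v, |truncFracLap s φ v δ| ≤ c) :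
    (∫ v, φ v * ((u v / M v) ^ 2 * fracLap s M v)) - c * ∫ v, u v ^ 2 / M v
      ≤ ∫ v, φ v * (2 * (u v / M v) * fracLap s u v) := by
  set F : ℝ → ℝ := fun w => u w ^ 2 / M w with hFdef
  have hF0 : ∀ w, 0 ≤ F w := fun w => div_nonneg (sq_nonneg _) (hMpos w).le
  have hFc : ContDiff ℝ 2 F := (hu.pow 2).div hM fun w => (hMpos w).ne'
  have hhc : Continuous fun v => u v / M v := hu.continuous.div hM.continuous fun w => (hMpos w).ne'
  have hB0 : 0 ≤ B := (hMpos 0).le.trans (hMB 0)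
  have hule : ∀ w, |u w| ≤ F w + B := fun w => by
    have h1 := hMpos w
    have h2 : 2 * |u w| ≤ u w ^ 2 / M w + M w := by
      rw [← sub_nonneg]
      have : u w ^ 2 / M w + M w - 2 * |u w| = (|u w| - M w) ^ 2 / M w := by
        field_simp; rw [← sq_abs (u w)]; ring
      rw [this]; positivity
    have h3 := hMB w
    have h4 := hF0 w
    simp only [hFdef] at h4 ⊢
    linarith
  have hMle : ∀ w, |M w| ≤ F w + B := fun w => by
    rw [abs_of_pos (hMpos w)]; linarith [hF0 w, hMB w]
  have hFle : ∀ w, |F w| ≤ F w + B := fun w => by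
    rw [abs_of_nonneg (hF0 w)]; linarith
  obtain ⟨K, hK⟩ := hφc.isBounded.exists_norm_le
  have hφK : ∀ v, φ v ≠ 0 → |v| ≤ K := fun v hv => hK v (subset_tsupport φ hv)
  -- integrability and domination of `φ a A_δ g` for the three functions `g` at hand
  have key : ∀ (a g : ℝ → ℝ), Continuous a → ContDiff ℝ 2 g → (∀ w, |g w| ≤ F w + B) →
      ∃ b : ℝ → ℝ, Integrable b ∧ ∀ δ, 0 < δ →
        AEStronglyMeasurable (fun v => φ v * (a v * truncFracLap s g v δ)) ∧
        ∀ v, ‖φ v * (a v * truncFracLap s g v δ)‖ ≤ b v := by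
    intro a g ha hg hgle
    obtain ⟨N, hN⟩ := exists_abs_truncFracLap_le hs0 hs1 hg hF hF0 hgle K
    refine ⟨fun v => φ v * (|a v| * N), ?_, fun δ hδ => ⟨?_, fun v => ?_⟩⟩
    · exact (by fun_prop : Continuous fun v => φ v * (|a v| * N)).integrable_of_hasCompactSupport
        hφc.mul_right
    · exact hφ.aestronglyMeasurable.mul (ha.aestronglyMeasurable.mul
        (stronglyMeasurable_truncFracLap s δ hg.continuous.measurable).aestronglyMeasurable)
    · by_cases hv : φ v = 0
      · simp [hv]
      · rw [norm_mul, norm_mul, Real.norm_eq_abs, abs_of_nonneg (hφ0 v)]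
        exact mul_le_mul_of_nonneg_left
          (mul_le_mul_of_nonneg_left (hN v (hφK v hv) δ hδ) (abs_nonneg _)) (hφ0 v)
  have lim : ∀ (a g : ℝ → ℝ), Continuous a → ContDiff ℝ 2 g → (∀ w, |g w| ≤ F w + B) →
      (∀ v, FracLapExists s g v) →
      Tendsto (fun δ => ∫ v, φ v * (a v * truncFracLap s g v δ)) (𝓝[>] 0)
        (𝓝 (∫ v, φ v * (a v * fracLap s g v))) := by
    intro a g ha hg hgle hgL
    obtain ⟨b, hb, hb2⟩ := key a g ha hg hgle
    refine tendsto_integral_filter_of_dominated_convergence b ?_ ?_ hb ?_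
    · filter_upwards [self_mem_nhdsWithin] with δ hδ using (hb2 δ hδ).1
    · filter_upwards [self_mem_nhdsWithin] with δ hδ using .of_forall (hb2 δ hδ).2
    · exact .of_forall fun v => ((hgL v).hasFracLap.2.const_mul _).const_mul _
  have int : ∀ (a g : ℝ → ℝ), Continuous a → ContDiff ℝ 2 g → (∀ w, |g w| ≤ F w + B) →
      ∀ δ, 0 < δ → Integrable fun v => φ v * (a v * truncFracLap s g v δ) := by
    intro a g ha hg hgle δ hδ
    obtain ⟨b, hb, hb2⟩ := key a g ha hg hgle
    exact hb.mono' (hb2 δ hδ).1 (.of_forall (hb2 δ hδ).2)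
  obtain ⟨Bφ, hBφ⟩ := hφ.bounded_above_of_compact_support hφc
  refine le_of_tendsto_of_tendsto ((lim (fun v => (u v / M v) ^ 2) M (by fun_prop) hM hMle
    hML).sub_const _) (lim (fun v => 2 * (u v / M v)) u (by fun_prop) hu hule huL) ?_
  filter_upwards [self_mem_nhdsWithin] with δ hδ
  have i1 := int (fun v => (u v / M v) ^ 2) M (by fun_prop) hM hMle δ hδ
  have i2 := int (fun v => 2 * (u v / M v)) u (by fun_prop) hu hule δ hδ
  have i3 : Integrable fun v => φ v * truncFracLap s F v δ := by
    simpa using int (fun _ => 1) F (by fun_prop) hFc hFle δ hδ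
  have h1 : (∫ v, φ v * truncFracLap s F v δ) + ∫ v, φ v * ((u v / M v) ^ 2 * truncFracLap s M v δ)
      ≤ ∫ v, φ v * (2 * (u v / M v) * truncFracLap s u v δ) := by
    rw [← integral_add i3 i1]
    refine integral_mono (i3.add i1) i2 fun v => ?_
    beta_reduce
    rw [← mul_add]
    exact mul_le_mul_of_nonneg_left (truncFracLap_sq_div_le hs0 hMpos
      (integrableOn_fracKernel_of_le hs0 hδ hu.continuous hF hule v)
      (integrableOn_fracKernel_of_le hs0 hδ hM.continuous hF hMle v)
      (integrableOn_fracKernel_of_le hs0 hδ hFc.continuous hF hFle v)) (hφ0 v)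
  rw [integral_mul_truncFracLap hs0 hδ hF hφ.aestronglyMeasurable hBφ] at h1
  have h2 : -(c * ∫ v, F v) ≤ ∫ v, F v * truncFracLap s φ v δ := by
    have hb : ∀ v, ‖F v * truncFracLap s φ v δ‖ ≤ c * F v := fun v => by
      rw [norm_mul, Real.norm_eq_abs, abs_of_nonneg (hF0 v), mul_comm]
      exact mul_le_mul_of_nonneg_right (hφB δ hδ v) (hF0 v)
    have := norm_integral_le_of_norm_le (hF.const_mul c) (.of_forall hb)
    rw [integral_const_mul, Real.norm_eq_abs] at this
    exact (abs_le.1 this).1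
  linarith

/-! ### Cutoffs -/

/-- A `C²` cutoff `φ` with values in `[0, 1]`, equal to `1` on `[-1/κ, 1/κ]`, that is almost
invisible to the operators at hand: `φ'`, `v φ'` and all truncated fractional Laplacians of `φ` are
at most `κ` everywhere. -/
structure IsCutoff (s κ : ℝ) (φ : ℝ → ℝ) : Prop where
  contDiff : ContDiff ℝ 2 φ
  hasCompactSupport : HasCompactSupport φ
  nonneg : ∀ v, 0 ≤ φ v
  le_one : ∀ v, φ v ≤ 1
  eq_one : ∀ v, |v| ≤ κ⁻¹ → φ v = 1
  abs_deriv_le : ∀ v, |deriv φ v| ≤ κ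
  abs_mul_deriv_le : ∀ v, |v * deriv φ v| ≤ κ
  abs_truncFracLap_le : ∀ δ, 0 < δ → ∀ v, |truncFracLap s φ v δ| ≤ κ

/-- Cutoffs exist: take `φ(v) = χ(log(1 + v²) / R)` with a fixed bump `χ` and large `R`. The
logarithm makes even `v φ'(v)` of size `1/R`. -/
theorem exists_isCutoff {s κ : ℝ} (hs0 : 0 < s) (hs1 : s < 1) (hκ : 0 < κ) :
    ∃ φ, IsCutoff s κ φ := by
  let χ : ContDiffBump (0 : ℝ) := ⟨1, 2, one_pos, one_lt_two⟩
  have hχ : ContDiff ℝ 2 χ := χ.contDiff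
  have hχ1 : Differentiable ℝ χ := hχ.differentiable (by norm_num)
  have hχ' : ContDiff ℝ 1 (deriv χ) := ((contDiff_succ_iff_deriv (n := 1)).1 hχ).2.2
  have hχ2 : Differentiable ℝ (deriv χ) := hχ'.differentiable (by norm_num)
  obtain ⟨A, hA⟩ := hχ'.continuous.bounded_above_of_compact_support χ.hasCompactSupport.deriv
  obtain ⟨A', hA'⟩ := (hχ'.continuous_deriv (by norm_num)).bounded_above_of_compact_support
    χ.hasCompactSupport.deriv.deriv
  have hA0 : 0 ≤ A := (norm_nonneg _).trans (hA 0)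
  have hA'0 : 0 ≤ A' := (norm_nonneg _).trans (hA' 0)
  -- the majorant of the second differences, up to a small factor
  set q : ℝ → ℝ := fun z => if |z| ≤ 1 then 2 * z ^ 2 else 2 * |z| ^ s with hq
  have hqm : Measurable q := Measurable.ite
    (measurableSet_le continuous_abs.measurable measurable_const) (by fun_prop) (by fun_prop)
  have hqi : Integrable fun z => q z * (|z| ^ (1 + 2 * s))⁻¹ := by
    refine integrable_mul_kernel_of_le (D := 2) (N := 2) hs0 hs1 hqm.aestronglyMeasurable ?_ ?_
    · intro z hz
      simp only [hq, hz, if_true]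
      rw [abs_of_nonneg (by positivity)]
    · intro z hz
      simp only [hq, not_le.2 hz, if_false]
      rw [abs_of_nonneg (by positivity)]
  set I : ℝ := ∫ z, q z * (|z| ^ (1 + 2 * s))⁻¹ with hI
  have t1 : Tendsto (fun R : ℝ => (A' + 2 * A) / R) atTop (𝓝 0) :=
    tendsto_const_nhds.div_atTop tendsto_id
  have t2 : Tendsto (fun R : ℝ => (A / R) ^ s) atTop (𝓝 0) := by
    have h : Tendsto (fun R : ℝ => A / R) atTop (𝓝 0) := tendsto_const_nhds.div_atTop tendsto_id
    have := h.rpow_const (p := s) (Or.inr hs0.le)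
    rwa [Real.zero_rpow hs0.ne'] at this
  have t3 : Tendsto (fun R : ℝ => fracConst s * (((A' + 2 * A) / R + (A / R) ^ s) * I)) atTop
      (𝓝 0) := by
    simpa using ((t1.add t2).mul_const I).const_mul (fracConst s)
  obtain ⟨R, hR1, hRκ, hRI, hRlog⟩ := ((eventually_ge_atTop (1 : ℝ)).and
    ((t1.eventually_le_const hκ).and ((t3.eventually_le_const hκ).and
    (eventually_ge_atTop (Real.log (1 + κ⁻¹ ^ 2)))))).exists
  have hR0 : 0 < R := by linarith
  set ℓ : ℝ → ℝ := fun v => Real.log (1 + v ^ 2) with hℓ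
  have hpos : ∀ v : ℝ, 0 < 1 + v ^ 2 := fun v => by positivity
  have hℓc : ContDiff ℝ 2 ℓ := ContDiff.log (by fun_prop) fun v => (hpos v).ne'
  have hℓd : ∀ v, HasDerivAt ℓ (2 * v / (1 + v ^ 2)) v := fun v => by
    have h : HasDerivAt (fun v : ℝ => 1 + v ^ 2) (2 * v) v := by
      simpa using (hasDerivAt_pow 2 v).const_add 1
    exact h.log (hpos v).ne'
  have hℓdd : ∀ v : ℝ, HasDerivAt (fun v : ℝ => 2 * v / (1 + v ^ 2))
      ((2 * (1 + v ^ 2) - 2 * v * (2 * v)) / (1 + v ^ 2) ^ 2) v := fun v => by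
    have h : HasDerivAt (fun v : ℝ => 1 + v ^ 2) (2 * v) v := by
      simpa using (hasDerivAt_pow 2 v).const_add 1
    have h' : HasDerivAt (fun v : ℝ => 2 * v) 2 v := by
      simpa using (hasDerivAt_id v).const_mul 2
    exact h'.div h (hpos v).ne'
  have b1 : ∀ v : ℝ, |2 * v / (1 + v ^ 2)| ≤ 1 := fun v => by
    rw [abs_div, abs_of_pos (hpos v), div_le_one (hpos v), abs_mul, abs_two, ← sq_abs v]
    nlinarith [sq_nonneg (|v| - 1)]
  have b2 : ∀ v : ℝ, |v * (2 * v / (1 + v ^ 2))| ≤ 2 := fun v => by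
    have e : v * (2 * v / (1 + v ^ 2)) = 2 * v ^ 2 / (1 + v ^ 2) := by ring
    rw [e, abs_of_nonneg (by positivity), div_le_iff₀ (hpos v)]
    nlinarith
  have b3 : ∀ v : ℝ, |(2 * (1 + v ^ 2) - 2 * v * (2 * v)) / (1 + v ^ 2) ^ 2| ≤ 2 := fun v => by
    rw [abs_div, abs_of_pos (pow_pos (hpos v) 2), div_le_iff₀ (pow_pos (hpos v) 2), abs_le]
    constructor <;> nlinarith [sq_nonneg v, sq_nonneg (v ^ 2)]
  set φ : ℝ → ℝ := fun v => χ (ℓ v / R) with hφ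
  have hφc : ContDiff ℝ 2 φ := hχ.comp (hℓc.div_const R)
  have hφd : ∀ v, HasDerivAt φ (deriv χ (ℓ v / R) * (2 * v / (1 + v ^ 2) / R)) v := fun v =>
    (hχ1 _).hasDerivAt.comp v ((hℓd v).div_const R)
  have hφ' : deriv φ = fun v => deriv χ (ℓ v / R) * (2 * v / (1 + v ^ 2) / R) :=
    funext fun v => (hφd v).deriv
  have hφdd : ∀ v, |deriv (deriv φ) v| ≤ (A' + 2 * A) / R := fun v => by
    have h := ((hχ2 (ℓ v / R)).hasDerivAt.comp v ((hℓd v).div_const R)).mul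
      ((hℓdd v).div_const R)
    rw [hφ']
    have h' := h.deriv
    simp only [Function.comp_def] at h'
    change |deriv (fun v => deriv χ (ℓ v / R) * (2 * v / (1 + v ^ 2) / R)) v| ≤ _
    erw [h']
    have p1 : |deriv (deriv χ) (ℓ v / R) * (2 * v / (1 + v ^ 2) / R) *
        (2 * v / (1 + v ^ 2) / R)| ≤ A' / R := by
      have e : deriv (deriv χ) (ℓ v / R) * (2 * v / (1 + v ^ 2) / R) * (2 * v / (1 + v ^ 2) / R)
        = (deriv (deriv χ) (ℓ v / R)) * (2 * v / (1 + v ^ 2)) * (2 * v / (1 + v ^ 2)) / (R * R) := by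
        field_simp
      rw [e, abs_div, abs_mul, abs_mul, abs_of_pos (mul_pos hR0 hR0)]
      have hR2 : R ≤ R * R := by nlinarith
      calc _ ≤ A' * 1 * 1 / (R * R) := by
            gcongr
            · exact hA' _
            · exact b1 v
            · exact b1 v
        _ ≤ A' / R := by rw [mul_one, mul_one]; gcongr
    have p2 : |deriv χ (ℓ v / R) * ((2 * (1 + v ^ 2) - 2 * v * (2 * v)) / (1 + v ^ 2) ^ 2 / R)|
        ≤ 2 * A / R := by
      rw [← mul_div_assoc, abs_div, abs_mul, abs_of_pos hR0, mul_comm 2 A]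
      gcongr
      · exact hA _
      · exact b3 v
    refine (abs_add_le _ _).trans ?_
    rw [add_div]
    exact add_le_add p1 p2
  have hφ1 : ∀ v, |deriv φ v| ≤ A / R := fun v => by
    rw [hφ']
    beta_reduce
    rw [← mul_div_assoc, abs_div, abs_mul, abs_of_pos hR0]
    gcongr
    have := mul_le_mul (hA (ℓ v / R)) (b1 v) (abs_nonneg _) hA0
    rwa [mul_one, Real.norm_eq_abs] at this
  have hle1 : ∀ v, φ v ≤ 1 := fun v => χ.le_one
  have hge0 : ∀ v, 0 ≤ φ v := fun v => χ.nonneg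
  have hdiff : ∀ x y, |φ x - φ y| ≤ (A / R) ^ s * |x - y| ^ s := fun x y => by
    have m : |φ x - φ y| ≤ A / R * |x - y| := by
      have := convex_univ.norm_image_sub_le_of_norm_deriv_le (f := φ) (C := A / R)
        (fun x _ => (hφd x).differentiableAt) (fun x _ => hφ1 x) (mem_univ y) (mem_univ x)
      simpa [Real.norm_eq_abs] using this
    have m1 : |φ x - φ y| ≤ 1 := abs_le.2 ⟨by linarith [hle1 y, hge0 x], by linarith [hle1 x, hge0 y]⟩
    have m0 : 0 ≤ A / R := by positivity
    rw [← Real.mul_rpow m0 (abs_nonneg _)]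
    calc |φ x - φ y| = |φ x - φ y| ^ (1 : ℝ) := (Real.rpow_one _).symm
      _ ≤ |φ x - φ y| ^ s :=
          Real.rpow_le_rpow_of_exponent_ge' (abs_nonneg _) m1 hs0.le hs1.le
      _ ≤ _ := Real.rpow_le_rpow (abs_nonneg _) m hs0.le
  have hsupp : HasCompactSupport φ := by
    refine HasCompactSupport.of_support_subset_isCompact
      (isCompact_closedBall (0 : ℝ) (Real.exp (2 * R))) fun v hv => ?_
    have h1 : |ℓ v / R| < 2 := by
      have : ℓ v / R ∈ Function.support χ := hv
      rw [χ.support_eq, Metric.mem_ball, Real.dist_eq, sub_zero] at this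
      exact this
    rw [abs_div, abs_of_pos hR0, div_lt_iff₀ hR0] at h1
    have h2 : 1 + v ^ 2 < Real.exp (2 * R) :=
      (Real.log_lt_iff_lt_exp (hpos v)).1 ((le_abs_self _).trans_lt h1)
    simp only [Metric.mem_closedBall, Real.dist_eq, sub_zero]
    rw [← sq_abs] at h2
    nlinarith [sq_nonneg (|v| - 1)]
  have hAR : A / R ≤ (A' + 2 * A) / R := by gcongr; linarith
  refine ⟨φ, hφc, hsupp, hge0, hle1, fun v hv => ?_, fun v => (hφ1 v).trans (hAR.trans hRκ),
    fun v => ?_, fun δ hδ v => ?_⟩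
  · refine χ.one_of_mem_closedBall ?_
    have h1 : ℓ v ≤ R := by
      refine (Real.log_le_log (hpos v) ?_).trans hRlog
      rw [← sq_abs v]
      gcongr
    have h0 : 0 ≤ ℓ v := Real.log_nonneg (by nlinarith [sq_nonneg v])
    simp only [Metric.mem_closedBall, Real.dist_eq, sub_zero]
    rw [abs_of_nonneg (by positivity)]
    exact (div_le_one hR0).2 h1
  · refine le_trans ?_ hRκ
    rw [hφ']
    have e : v * (deriv χ (ℓ v / R) * (2 * v / (1 + v ^ 2) / R))
        = deriv χ (ℓ v / R) * (v * (2 * v / (1 + v ^ 2))) / R := by ring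
    simp only
    rw [e, abs_div, abs_mul, abs_of_pos hR0]
    have := mul_le_mul (hA (ℓ v / R)) (b2 v) (abs_nonneg _) hA0
    rw [Real.norm_eq_abs] at this
    gcongr
    linarith
  · refine (abs_truncFracLap_le hs0 (integrableOn_fracKernel_of_le hs0 hδ hφc.continuous
      (F := fun _ => 0) (B := 1) (integrable_zero _ _ _) (fun w => ?_) v)
      (Q := fun z => ((A' + 2 * A) / R + (A / R) ^ s) * (q z * (|z| ^ (1 + 2 * s))⁻¹))
      (fun z => ?_) (hqi.const_mul _)).trans ?_
    · rw [zero_add, abs_of_nonneg (hge0 w)]; exact hle1 w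
    · rw [← mul_assoc]
      refine mul_le_mul_of_nonneg_right ?_ (by positivity)
      have c1 : 0 ≤ (A' + 2 * A) / R := by positivity
      have c2 : 0 ≤ (A / R) ^ s := by positivity
      by_cases hz : |z| ≤ 1
      · simp only [hq, hz, if_true]
        refine (abs_second_difference_le hφc fun y _ => hφdd y).trans ?_
        nlinarith [mul_nonneg c2 (sq_nonneg z)]
      · simp only [hq, hz, if_false]
        have d1 := hdiff v (v + z)
        have d2 := hdiff v (v - z)
        rw [show v - (v + z) = -z by ring, abs_neg] at d1
        rw [show v - (v - z) = z by ring] at d2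
        have e : 2 * φ v - φ (v + z) - φ (v - z) = (φ v - φ (v + z)) + (φ v - φ (v - z)) := by ring
        rw [e]
        have hzs : 0 ≤ |z| ^ s := by positivity
        nlinarith [abs_add_le (φ v - φ (v + z)) (φ v - φ (v - z)), mul_nonneg c1 hzs]
    · rw [integral_const_mul]
      exact hRI

/-! ### The weighted energy in one variable -/

theorem IsEquilibrium.fracLap_eq {s : ℝ} {M : ℝ → ℝ} (hM : IsEquilibrium s M) (v : ℝ) :
    fracLap s M v = M v + v * deriv M v := by
  have h := hM.levyFP_eq_zero v
  have hd := (hM.contDiff.differentiable (by norm_num) v).hasDerivAt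
  have h2 := ((hasDerivAt_id v).mul hd).deriv
  simp only [id, one_mul] at h2
  rw [levyFP, sub_eq_zero] at h
  rw [← h, ← h2]
  rfl

theorem integral_deriv_eq_zero_of_hasCompactSupport {g : ℝ → ℝ} (hg : ContDiff ℝ 1 g)
    (hc : HasCompactSupport g) : ∫ v, deriv g v = 0 :=
  integral_eq_zero_of_hasDerivAt_of_integrable
    (fun v => (hg.differentiable (by norm_num) v).hasDerivAt)
    ((hg.continuous_deriv le_rfl).integrable_of_hasCompactSupport hc.deriv)
    (hg.continuous.integrable_of_hasCompactSupport hc)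

/-- Testing `2 (u/M) ℒ^s u` against a cutoff in the velocity: up to the small commutators with the
cutoff it is nonpositive. The equation `ℒ^s M = 0` cancels the zeroth-order terms. -/
theorem integral_cutoff_levyFP_le {s B κ : ℝ} (hs0 : 0 < s) (hs1 : s < 1) {u M φ : ℝ → ℝ}
    (hM : IsEquilibrium s M) (hMB : ∀ w, M w ≤ B)
    (hu : ContDiff ℝ 2 u) (huL : ∀ v, FracLapExists s u v) (huc : Continuous (levyFP s u))
    (hF : Integrable fun w => u w ^ 2 / M w) (hφ : IsCutoff s κ φ) :
    ∫ v, φ v * (2 * (u v / M v) * levyFP s u v) ≤ 2 * κ * ∫ v, u v ^ 2 / M v := by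
  have core := integral_cutoff_fracLap_le hs0 hs1 hM.contDiff hM.pos hMB hM.fracLap_exists hu huL hF
    hφ.contDiff.continuous hφ.hasCompactSupport hφ.nonneg hφ.abs_truncFracLap_le
  have hne : ∀ w, M w ≠ 0 := fun w => (hM.pos w).ne'
  set F : ℝ → ℝ := fun w => u w ^ 2 / M w with hFdef
  have hF0 : ∀ w, 0 ≤ F w := fun w => div_nonneg (sq_nonneg _) (hM.pos w).le
  have hFc : ContDiff ℝ 1 F := ((hu.pow 2).div hM.contDiff hne).of_le (by norm_num)
  have hφ1 : ContDiff ℝ 1 φ := hφ.contDiff.of_le (by norm_num)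
  have hu1 : ContDiff ℝ 1 u := hu.of_le (by norm_num)
  have hM1 : ContDiff ℝ 1 M := hM.contDiff.of_le (by norm_num)
  have hcu := hu.continuous
  have hcM := hM.contDiff.continuous
  have hcφ := hφ1.continuous
  have hcu' := hu1.continuous_deriv le_rfl
  have hcM' := hM1.continuous_deriv le_rfl
  have hcφ' := hφ1.continuous_deriv le_rfl
  have hch : Continuous fun v => u v / M v := hcu.div hcM hne
  have hdu : ∀ v, HasDerivAt u (deriv u v) v := fun v =>
    (hu1.differentiable (by norm_num) v).hasDerivAt
  have hdM : ∀ v, HasDerivAt M (deriv M v) v := fun v =>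
    (hM1.differentiable (by norm_num) v).hasDerivAt
  have hdφ : ∀ v, HasDerivAt φ (deriv φ v) v := fun v =>
    (hφ1.differentiable (by norm_num) v).hasDerivAt
  have hlevy : ∀ v, fracLap s u v = u v + v * deriv u v - levyFP s u v := fun v => by
    have h2 := ((hasDerivAt_id v).mul (hdu v)).deriv
    simp only [id, one_mul] at h2
    have h3 : deriv (fun w => w * u w) v = u v + v * deriv u v := h2
    rw [levyFP, h3]; ring
  have cont_int : ∀ g : ℝ → ℝ, Continuous g → Integrable fun v => φ v * g v := fun g hg =>
    (hcφ.mul hg).integrable_of_hasCompactSupport hφ.hasCompactSupport.mul_right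
  have i1 := cont_int (fun v => 2 * (u v / M v) * levyFP s u v) (by fun_prop)
  have i2 := cont_int (fun v => 2 * (u v / M v) * fracLap s u v) (by
    simp only [hlevy]; fun_prop)
  have i3 := cont_int (fun v => (u v / M v) ^ 2 * fracLap s M v) (by
    simp only [hM.fracLap_eq]; fun_prop)
  have i4 : Integrable fun v => v * deriv φ v * F v :=
    (by fun_prop : Continuous fun v => v * deriv φ v * F v).integrable_of_hasCompactSupport
      (hφ.hasCompactSupport.deriv.mul_left.mul_right)
  -- the zeroth-order terms combine with the drift to an exact derivative
  have hprod : ContDiff ℝ 1 fun v => φ v * (v * F v) := hφ1.mul (contDiff_id.mul hFc)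
  have hder : ∀ v, deriv (fun v => φ v * (v * F v)) v = φ v * (2 * (u v / M v) * levyFP s u v)
      + φ v * (2 * (u v / M v) * fracLap s u v) - φ v * ((u v / M v) ^ 2 * fracLap s M v)
      + v * deriv φ v * F v := fun v => by
    have hFd := ((hdu v).pow 2).div (hdM v) (hne v)
    have h := ((hdφ v).mul ((hasDerivAt_id v).mul hFd)).deriv
    have h' : deriv (fun v => φ v * (v * F v)) v = _ := h
    rw [h', hlevy, hM.fracLap_eq]
    simp only [id, hFdef, Pi.pow_apply, Pi.mul_apply, Pi.div_apply]
    have := hne v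
    field_simp
    ring
  have hzero := integral_deriv_eq_zero_of_hasCompactSupport hprod hφ.hasCompactSupport.mul_right
  simp only [hder] at hzero
  have i12 : Integrable fun v => φ v * (2 * (u v / M v) * levyFP s u v)
      + φ v * (2 * (u v / M v) * fracLap s u v) := i1.add i2
  have i123 : Integrable fun v => φ v * (2 * (u v / M v) * levyFP s u v)
      + φ v * (2 * (u v / M v) * fracLap s u v) - φ v * ((u v / M v) ^ 2 * fracLap s M v) :=
    i12.sub i3
  rw [integral_add i123 i4, integral_sub i12 i3, integral_add i1 i2] at hzero
  have h4 : -(κ * ∫ v, F v) ≤ ∫ v, v * deriv φ v * F v := by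
    have hb : ∀ v, ‖v * deriv φ v * F v‖ ≤ κ * F v := fun v => by
      rw [norm_mul, Real.norm_eq_abs (F v), abs_of_nonneg (hF0 v)]
      exact mul_le_mul_of_nonneg_right (hφ.abs_mul_deriv_le v) (hF0 v)
    have := norm_integral_le_of_norm_le (hF.const_mul κ) (.of_forall hb)
    rw [integral_const_mul, Real.norm_eq_abs] at this
    exact (abs_le.1 this).1
  linarith

/-! ### Differentiating tested energies in time -/

/-- Differentiation under the integral sign against a compactly supported weight. -/
theorem hasDerivAt_integral_mul_of_hasCompactSupport {X : Type*} [TopologicalSpace X]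
    [MeasurableSpace X] [OpensMeasurableSpace X] {μ : Measure X} [IsFiniteMeasureOnCompacts μ]
    {G G' : ℝ → X → ℝ} {φ : X → ℝ} (hφ : Continuous φ) (hφc : HasCompactSupport φ)
    (hG : ∀ t, 0 < t → Continuous (G t))
    (hG' : ContinuousOn (fun q : ℝ × X => G' q.1 q.2) (Ioi 0 ×ˢ univ))
    (hd : ∀ t, 0 < t → ∀ p, HasDerivAt (fun r => G r p) (G' t p) t) {t : ℝ} (ht : 0 < t) :
    HasDerivAt (fun r => ∫ p, φ p * G r p ∂μ) (∫ p, φ p * G' t p ∂μ) t := by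
  have hK : IsCompact (Icc (t / 2) (2 * t) ×ˢ tsupport φ) := isCompact_Icc.prod hφc
  obtain ⟨B, hB⟩ := hK.exists_bound_of_continuousOn (hG'.mono (prod_mono
    (fun r hr => lt_of_lt_of_le (by positivity) hr.1) (subset_univ _)))
  have hint : ∀ r, 0 < r → Integrable (fun p => φ p * G r p) μ := fun r hr =>
    (hφ.mul (hG r hr)).integrable_of_hasCompactSupport hφc.mul_right
  have hc' : Continuous (G' t) := by
    have : Continuous fun p : X => ((t, p) : ℝ × X) := by fun_prop
    exact hG'.comp_continuous this fun p => ⟨ht, mem_univ _⟩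
  refine (hasDerivAt_integral_of_dominated_loc_of_deriv_le (F' := fun r p => φ p * G' r p)
    (bound := fun p => |φ p| * B) (s := Ioo (t / 2) (2 * t))
    (Ioo_mem_nhds (by linarith) (by linarith)) ?_ (hint t ht) ?_ ?_ ?_ ?_).2
  · filter_upwards [lt_mem_nhds ht] with r hr using (hint r hr).1
  · exact ((hφ.mul hc').integrable_of_hasCompactSupport hφc.mul_right).1
  · refine .of_forall fun p r hr => ?_
    rw [norm_mul, Real.norm_eq_abs]
    by_cases hp : φ p = 0
    · simp [hp]
    · exact mul_le_mul_of_nonneg_left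
        (hB (r, p) ⟨Ioo_subset_Icc_self hr, subset_tsupport φ hp⟩) (abs_nonneg _)
  · exact (hφ.abs.mul continuous_const).integrable_of_hasCompactSupport hφc.norm.mul_right
  · refine .of_forall fun p r hr => ?_
    exact (hd r (by linarith [hr.1]) p).const_mul (φ p)

/-- If the energy `∫ F(t)` is finite and, tested against cutoffs `φ n → 1`, its growth rate is at
most a small multiple of itself, then it does not grow. -/
theorem integral_le_of_tested_deriv_le {X : Type*} [MeasurableSpace X] {μ : Measure X}
    {F : ℝ → X → ℝ} {φ : ℕ → X → ℝ} {J' : ℕ → ℝ → ℝ} {c : ℕ → ℝ} {a b K : ℝ} (hab : a ≤ b)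
    (hF0 : ∀ t p, 0 ≤ F t p) (hF : ∀ t ∈ Icc a b, Integrable (F t) μ)
    (hFK : ∀ t ∈ Icc a b, ∫ p, F t p ∂μ ≤ K)
    (hφm : ∀ n, AEStronglyMeasurable (φ n) μ)
    (hφ0 : ∀ n p, 0 ≤ φ n p) (hφ1 : ∀ n p, φ n p ≤ 1)
    (hφ : ∀ p, Tendsto (fun n => φ n p) atTop (𝓝 1))
    (hJ : ∀ n, ∀ t ∈ Icc a b, HasDerivAt (fun r => ∫ p, φ n p * F r p ∂μ) (J' n t) t)
    (hc0 : ∀ n, 0 ≤ c n) (hc : Tendsto c atTop (𝓝 0))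
    (hJ' : ∀ n, ∀ t ∈ Icc a b, J' n t ≤ c n * ∫ p, F t p ∂μ) :
    ∫ p, F b p ∂μ ≤ ∫ p, F a p ∂μ := by
  have lim : ∀ t ∈ Icc a b, Tendsto (fun n => ∫ p, φ n p * F t p ∂μ) atTop (𝓝 (∫ p, F t p ∂μ)) := by
    intro t ht
    refine tendsto_integral_of_dominated_convergence (F t)
      (fun n => (hφm n).mul (hF t ht).1) (hF t ht) (fun n => .of_forall fun p => ?_)
      (.of_forall fun p => ?_)
    · rw [norm_mul, Real.norm_eq_abs, Real.norm_eq_abs, abs_of_nonneg (hφ0 n p),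
        abs_of_nonneg (hF0 t p)]
      exact mul_le_of_le_one_left (hF0 t p) (hφ1 n p)
    · simpa using (hφ p).mul_const (F t p)
  have step : ∀ n, (∫ p, φ n p * F b p ∂μ) - ∫ p, φ n p * F a p ∂μ ≤ c n * K * (b - a) := by
    intro n
    refine (convex_Icc a b).image_sub_le_mul_sub_of_deriv_le
      (f := fun r => ∫ p, φ n p * F r p ∂μ)
      (fun t ht => (hJ n t ht).continuousAt.continuousWithinAt)
      (fun t ht => (hJ n t (interior_subset ht)).differentiableAt.differentiableWithinAt)
      (fun t ht => ?_) a (left_mem_Icc.2 hab) b (right_mem_Icc.2 hab) hab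
    have ht' := interior_subset ht
    rw [(hJ n t ht').deriv]
    exact (hJ' n t ht').trans (mul_le_mul_of_nonneg_left (hFK t ht') (hc0 n))
  have h1 := (lim b (right_mem_Icc.2 hab)).sub (lim a (left_mem_Icc.2 hab))
  have h2 : Tendsto (fun n => c n * K * (b - a)) atTop (𝓝 0) := by
    simpa using (hc.mul_const K).mul_const (b - a)
  linarith [le_of_tendsto_of_tendsto' h1 h2 step]

theorem hasDerivAt_of_contDiffOn_time {X : Type*} [NormedAddCommGroup X] [NormedSpace ℝ X]
    {U : ℝ × X → ℝ} (hU : ContDiffOn ℝ 1 U (Ioi 0 ×ˢ univ)) {t : ℝ} (ht : 0 < t) (p : X) :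
    HasDerivAt (fun r => U (r, p)) (fderiv ℝ U (t, p) (1, 0)) t := by
  have ho : IsOpen ((Ioi (0 : ℝ)) ×ˢ (univ : Set X)) := isOpen_Ioi.prod isOpen_univ
  have hd : HasFDerivAt U (fderiv ℝ U (t, p)) (t, p) :=
    ((hU.differentiableOn (by norm_num)).differentiableAt
      (ho.mem_nhds (x := (t, p)) ⟨ht, mem_univ _⟩)).hasFDerivAt
  exact hd.comp_hasDerivAt t ((hasDerivAt_id t).prodMk (hasDerivAt_const t p))

theorem continuousOn_deriv_time {X : Type*} [NormedAddCommGroup X] [NormedSpace ℝ X]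
    {U : ℝ × X → ℝ} (hU : ContDiffOn ℝ 1 U (Ioi 0 ×ˢ univ)) :
    ContinuousOn (fun q : ℝ × X => deriv (fun r => U (r, q.2)) q.1) (Ioi 0 ×ˢ univ) := by
  have ho : IsOpen ((Ioi (0 : ℝ)) ×ˢ (univ : Set X)) := isOpen_Ioi.prod isOpen_univ
  have h := (hU.continuousOn_fderiv_of_isOpen ho le_rfl).clm_apply
    (continuousOn_const (c := ((1, 0) : ℝ × X)))
  exact h.congr fun q hq => (hasDerivAt_of_contDiffOn_time hU hq.1 q.2).deriv

/-- Time derivatives of the energy density `u² / m` tested against a weight. -/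
theorem hasDerivAt_integral_mul_sq_div {X : Type*} [NormedAddCommGroup X] [NormedSpace ℝ X]
    [MeasurableSpace X] [OpensMeasurableSpace X] {μ : Measure X} [IsFiniteMeasureOnCompacts μ]
    {U : ℝ × X → ℝ} (hU : ContDiffOn ℝ 1 U (Ioi 0 ×ˢ univ)) {m φ : X → ℝ} (hm : Continuous m)
    (hm0 : ∀ p, m p ≠ 0) (hφ : Continuous φ) (hφc : HasCompactSupport φ) {t : ℝ} (ht : 0 < t) :
    HasDerivAt (fun r => ∫ p, φ p * (U (r, p) ^ 2 / m p) ∂μ)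
      (∫ p, φ p * (2 * (U (t, p) / m p) * deriv (fun r => U (r, p)) t) ∂μ) t := by
  refine hasDerivAt_integral_mul_of_hasCompactSupport hφ hφc (G := fun r p => U (r, p) ^ 2 / m p)
    (G' := fun t p => 2 * (U (t, p) / m p) * deriv (fun r => U (r, p)) t) ?_ ?_ ?_ ht
  · intro r hr
    have h : Continuous fun p => U (r, p) :=
      hU.continuousOn.comp_continuous (by fun_prop) fun p => ⟨hr, mem_univ _⟩
    exact (h.pow 2).div hm hm0
  · exact (continuousOn_const.mul (hU.continuousOn.div (hm.comp continuous_snd).continuousOn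
      fun q _ => hm0 q.2)).mul (continuousOn_deriv_time hU)
  · intro r hr p
    have h := hasDerivAt_of_contDiffOn_time hU hr p
    rw [h.deriv]
    refine ((h.pow 2).div_const (m p)).congr_deriv ?_
    simp only [Nat.cast_ofNat]
    ring

/-! ### Curves in `L²` -/

theorem toReal_eLpNorm_two_sq {α : Type*} [MeasurableSpace α] {μ : Measure α} {u : α → ℝ}
    (hu : MemLp u 2 μ) : (eLpNorm u 2 μ).toReal ^ 2 = ∫ p, u p ^ 2 ∂μ := by
  have h0 : 0 ≤ ∫ p, ‖u p‖ ^ (2 : ℝ) ∂μ := integral_nonneg fun p => by positivity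
  rw [hu.eLpNorm_eq_integral_rpow_norm (by norm_num) (by norm_num)]
  simp only [ENNReal.toReal_ofNat]
  rw [ENNReal.toReal_ofReal (by positivity), ← Real.rpow_natCast, ← Real.rpow_mul h0]
  norm_num

theorem abs_toReal_eLpNorm_sub_le {α : Type*} [MeasurableSpace α] {μ : Measure α} {u w : α → ℝ}
    (hu : MemLp u 2 μ) (hw : MemLp w 2 μ) :
    |(eLpNorm u 2 μ).toReal - (eLpNorm w 2 μ).toReal|
      ≤ (eLpNorm (fun p => u p - w p) 2 μ).toReal := by
  have h := abs_norm_sub_norm_le (hu.toLp u) (hw.toLp w)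
  rw [← MemLp.toLp_sub, Lp.norm_toLp, Lp.norm_toLp, Lp.norm_toLp] at h
  exact h

theorem IsL2Curve.continuousOn_eLpNorm {α : Type*} [MeasurableSpace α] {μ : Measure α}
    {u : ℝ → α → ℝ} (hu : IsL2Curve μ u) :
    ContinuousOn (fun t => (eLpNorm (u t) 2 μ).toReal) (Ici 0) := by
  intro t ht
  have h := (ENNReal.tendsto_toReal ENNReal.zero_ne_top).comp (hu.continuous t ht)
  rw [ContinuousWithinAt, tendsto_iff_dist_tendsto_zero]
  refine squeeze_zero' (.of_forall fun _ => dist_nonneg) ?_ h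
  filter_upwards [self_mem_nhdsWithin] with r hr
  exact abs_toReal_eLpNorm_sub_le (hu.memLp r hr) (hu.memLp t ht)

/-- A continuous function on `[0,∞)` that is antitone on `(0,∞)` is antitone. -/
theorem antitoneOn_Ici_of_Ioi {N : ℝ → ℝ} (hN : ContinuousOn N (Ici 0))
    (h : ∀ a b, 0 < a → a ≤ b → N b ≤ N a) : AntitoneOn N (Ici 0) := by
  intro a ha b hb hab
  rcases (show (0 : ℝ) ≤ a from ha).eq_or_lt with rfl | ha0
  · rcases (show (0 : ℝ) ≤ b from hb).eq_or_lt with rfl | hb0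
    · exact le_rfl
    · have ht : Tendsto N (𝓝[>] 0) (𝓝 (N 0)) :=
        (hN 0 ha).mono_left (nhdsWithin_mono _ Ioi_subset_Ici_self)
      refine ge_of_tendsto ht ?_
      filter_upwards [Ioo_mem_nhdsGT hb0] with r hr using h r b hr.1 hr.2.le
  · exact h a b ha0 hab

/-! ### Uniqueness for the fractional heat equation -/

theorem hasFracLap_const (s c x : ℝ) : HasFracLap s (fun _ => c) x 0 := by
  have h : fracKernel s (fun _ => c) x = fun _ => 0 := by ext y; simp [fracKernel]
  refine ⟨fun δ _ => by rw [h]; exact integrableOn_zero, ?_⟩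
  have h2 : truncFracLap s (fun _ => c) x = fun _ => 0 := by
    ext δ; rw [truncFracLap, h]; simp
  rw [h2]; exact tendsto_const_nhds

theorem tendsto_one_of_isCutoff {s : ℝ} {φ : ℕ → ℝ → ℝ} {κ : ℕ → ℝ} (h : ∀ n, IsCutoff s (κ n) (φ n))
    (hκ0 : ∀ n, 0 < κ n) (hκ : ∀ n : ℕ, κ n ≤ 1 / ((n : ℝ) + 1)) (x : ℝ) :
    Tendsto (fun n => φ n x) atTop (𝓝 1) := by
  refine tendsto_const_nhds.congr' ?_
  filter_upwards [(tendsto_natCast_atTop_atTop (R := ℝ)).eventually_ge_atTop |x|] with n hn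
  refine ((h n).eq_one x ?_).symm
  have h1 : (n : ℝ) + 1 ≤ (κ n)⁻¹ := by
    rw [le_inv_comm₀ (by positivity) (hκ0 n), ← one_div]
    exact hκ n
  linarith

/-- A classical solution of the fractional heat equation in `C([0,∞); L²)` with zero initial data
vanishes. -/
theorem eq_zero_of_fractional_heat {s : ℝ} (hs0 : 0 < s) (hs1 : s < 1) {u : ℝ → ℝ → ℝ}
    (hcurve : IsL2Curve volume u)
    (hu1 : ContDiffOn ℝ 1 (fun q : ℝ × ℝ => u q.1 q.2) (Ioi 0 ×ˢ univ))
    (hu2 : ∀ t, 0 < t → ContDiff ℝ 2 (u t))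
    (huL : ∀ t, 0 < t → ∀ x, FracLapExists s (u t) x)
    (heq : ∀ t, 0 < t → ∀ x, deriv (fun r => u r x) t = -fracLap s (u t) x)
    (h0 : ∀ x, u 0 x = 0) {t : ℝ} (ht : 0 < t) (x : ℝ) : u t x = 0 := by
  set N : ℝ → ℝ := fun t => (eLpNorm (u t) 2 volume).toReal with hN
  have hNc : ContinuousOn N (Ici 0) := hcurve.continuousOn_eLpNorm
  have hNsq : ∀ t, 0 ≤ t → N t ^ 2 = ∫ x, u t x ^ 2 / 1 := fun t ht => by
    simp only [div_one]; exact toReal_eLpNorm_two_sq (hcurve.memLp t ht)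
  have hFi : ∀ t, 0 ≤ t → Integrable fun x => u t x ^ 2 / 1 := fun t ht => by
    simp only [div_one]; exact (hcurve.memLp t ht).integrable_sq
  have hdec : ∀ a b, 0 < a → a ≤ b → N b ≤ N a := by
    intro a b ha hab
    have hpos : ∀ t ∈ Icc a b, 0 < t := fun t ht => ha.trans_le ht.1
    choose φ hφ using fun n : ℕ => exists_isCutoff (κ := 1 / ((n : ℝ) + 1)) hs0 hs1
      Nat.one_div_pos_of_nat
    obtain ⟨K, hK⟩ := (isCompact_Icc (a := a) (b := b)).exists_bound_of_continuousOn
      ((hNc.mono fun t ht => (hpos t ht).le).pow 2)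
    have key := integral_le_of_tested_deriv_le (μ := volume) (F := fun t x => u t x ^ 2 / 1)
      (φ := φ) (J' := fun n t => ∫ x, φ n x * (2 * (u t x / 1) * deriv (fun r => u r x) t))
      (c := fun n : ℕ => 1 / ((n : ℝ) + 1)) (K := K) hab
      (fun t x => by positivity) (fun t ht => hFi t (hpos t ht).le)
      (fun t ht => by rw [← hNsq t (hpos t ht).le]; exact (le_abs_self _).trans (hK t ht))
      (fun n => (hφ n).contDiff.continuous.aestronglyMeasurable)
      (fun n => (hφ n).nonneg) (fun n => (hφ n).le_one)
      (tendsto_one_of_isCutoff hφ (fun n => Nat.one_div_pos_of_nat) (fun n => le_rfl))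
      (fun n t ht => hasDerivAt_integral_mul_sq_div hu1 (m := fun _ => 1) continuous_const
        (fun _ => one_ne_zero) (hφ n).contDiff.continuous (hφ n).hasCompactSupport (hpos t ht))
      (fun n => Nat.one_div_pos_of_nat.le) tendsto_one_div_add_atTop_nhds_zero_nat
      (fun n t ht => ?_)
    · rw [← hNsq b (ha.le.trans hab), ← hNsq a ha.le] at key
      exact (sq_le_sq₀ ENNReal.toReal_nonneg ENNReal.toReal_nonneg).1 key
    · have ht0 := hpos t ht
      have h := integral_cutoff_fracLap_le hs0 hs1 (M := fun _ => 1) (B := 1) contDiff_const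
        (fun _ => one_pos) (fun _ => le_rfl) (fun v => ⟨0, hasFracLap_const s 1 v⟩) (hu2 t ht0)
        (huL t ht0) (hFi t ht0.le) (hφ n).contDiff.continuous (hφ n).hasCompactSupport (hφ n).nonneg
        (hφ n).abs_truncFracLap_le
      simp only [(hasFracLap_const s 1 _).fracLap_eq, mul_zero, integral_zero] at h
      simp only [heq t ht0, mul_neg, integral_neg]
      linarith
  have hanti := antitoneOn_Ici_of_Ioi hNc hdec
  have hN0 : N 0 = 0 := by
    have : u 0 = 0 := funext h0
    simp [hN, this]
  have hNt : N t ≤ 0 := hN0 ▸ hanti (mem_Ici.2 le_rfl) (mem_Ici.2 ht.le) ht.le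
  have hNt0 : eLpNorm (u t) 2 volume = 0 := by
    have h1 : N t = 0 := le_antisymm hNt ENNReal.toReal_nonneg
    exact ((ENNReal.toReal_eq_zero_iff _).1 h1).resolve_right (hcurve.memLp t ht.le).2.ne
  rw [eLpNorm_eq_zero_iff (hcurve.memLp t ht.le).1 (by norm_num)] at hNt0
  have := (hu2 t ht).continuous.ae_eq_iff_eq volume continuous_zero |>.1 hNt0
  exact congrFun this x

/-! ### Dissipation on phase space -/

/-- The kinetic equation tested at a fixed time against a product of cutoffs `α(x) β(v)`. The
transport term is integrated by parts; the cutoff `α` varies so slowly that `v α'(x)` is small on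
the support of `β`. Here `T` stands for `ε^{2s} ∂_t f`. -/
theorem integral_phase_cutoff_le {s ε B κ κ' V : ℝ} (hs0 : 0 < s) (hs1 : s < 1) (hε : 0 < ε)
    {M α β : ℝ → ℝ} {w T : ℝ × ℝ → ℝ} (hM : IsEquilibrium s M) (hMB : ∀ v, M v ≤ B)
    (hw : ContDiff ℝ 2 w) (hwL : ∀ x v, FracLapExists s (fun v => w (x, v)) v)
    (hT : Continuous T)
    (heq : ∀ x v, T (x, v) + ε * v * deriv (fun y => w (y, v)) x = levyFP s (fun v => w (x, v)) v)
    (hF : Integrable fun p : ℝ × ℝ => w p ^ 2 / M p.2)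
    (hα : IsCutoff s κ' α) (hβ : IsCutoff s κ β) (hκ : 0 ≤ κ)
    (hV : ∀ v, β v ≠ 0 → |v| ≤ V) (hκ' : κ' * V ≤ κ) (hκ'0 : 0 ≤ κ') :
    ∫ p : ℝ × ℝ, α p.1 * β p.2 * (2 * (w p / M p.2) * T p)
      ≤ (2 + ε) * κ * ∫ p : ℝ × ℝ, w p ^ 2 / M p.2 := by
  have hne : ∀ v, M v ≠ 0 := fun v => (hM.pos v).ne'
  set F : ℝ × ℝ → ℝ := fun p => w p ^ 2 / M p.2 with hFdef
  have hF0 : ∀ p, 0 ≤ F p := fun p => div_nonneg (sq_nonneg _) (hM.pos _).le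
  have hcα := hα.contDiff.continuous
  have hcβ := hβ.contDiff.continuous
  have hcα' : Continuous (deriv α) :=
    (hα.contDiff.of_le (by norm_num : (1 : WithTop ℕ∞) ≤ 2)).continuous_deriv le_rfl
  have hcw := hw.continuous
  have hcM := hM.contDiff.continuous
  have hM2 : ContDiff ℝ 2 fun p : ℝ × ℝ => M p.2 := hM.contDiff.comp contDiff_snd
  have hFc : ContDiff ℝ 1 F := ((hw.pow 2).div hM2 fun p => hne p.2).of_le (by norm_num)
  have hcF := hFc.continuous
  have hch : Continuous fun p : ℝ × ℝ => w p / M p.2 := hcw.div hM2.continuous fun p => hne p.2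
  -- the spatial derivative
  have hdx : ∀ x v, HasDerivAt (fun y => w (y, v)) (fderiv ℝ w (x, v) (1, 0)) x := fun x v =>
    (hw.differentiable (by norm_num) (x, v)).hasFDerivAt.comp_hasDerivAt x
      ((hasDerivAt_id x).prodMk (hasDerivAt_const x v))
  set D : ℝ × ℝ → ℝ := fun p => fderiv ℝ w p (1, 0) with hD
  have hcD : Continuous D := (hw.continuous_fderiv (by norm_num)).clm_apply continuous_const
  have heq' : ∀ x v, levyFP s (fun v => w (x, v)) v = T (x, v) + ε * v * D (x, v) := fun x v => by
    rw [← heq, (hdx x v).deriv]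
  -- products with the cutoffs have compact support
  have hsupp : HasCompactSupport fun p : ℝ × ℝ => α p.1 * β p.2 := by
    refine HasCompactSupport.of_support_subset_isCompact
      (hα.hasCompactSupport.isCompact.prod hβ.hasCompactSupport.isCompact) fun p hp => ?_
    have hp' : α p.1 * β p.2 ≠ 0 := hp
    exact ⟨subset_tsupport _ (left_ne_zero_of_mul hp'), subset_tsupport _ (right_ne_zero_of_mul hp')⟩
  have hsupp' : HasCompactSupport fun p : ℝ × ℝ => deriv α p.1 * β p.2 := by
    refine HasCompactSupport.of_support_subset_isCompact
      (hα.hasCompactSupport.deriv.isCompact.prod hβ.hasCompactSupport.isCompact) fun p hp => ?_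
    have hp' : deriv α p.1 * β p.2 ≠ 0 := hp
    exact ⟨subset_tsupport _ (left_ne_zero_of_mul hp'), subset_tsupport _ (right_ne_zero_of_mul hp')⟩
  have ci : ∀ g : ℝ × ℝ → ℝ, Continuous g →
      Integrable (fun p : ℝ × ℝ => α p.1 * β p.2 * g p) (volume.prod volume) := fun g hg =>
    (by fun_prop : Continuous fun p : ℝ × ℝ => α p.1 * β p.2 * g p).integrable_of_hasCompactSupport
      hsupp.mul_right
  have hFi : Integrable F (volume.prod volume) := hF
  have iT := ci (fun p => 2 * (w p / M p.2) * T p) (by fun_prop)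
  have iD := ci (fun p => 2 * (w p / M p.2) * (ε * p.2 * D p)) (by fun_prop)
  have iL := ci (fun p => 2 * (w p / M p.2) * (T p + ε * p.2 * D p)) (by fun_prop)
  -- the collision operator, slice by slice
  have h1 : ∫ p : ℝ × ℝ, α p.1 * β p.2 * (2 * (w p / M p.2) * (T p + ε * p.2 * D p))
      ≤ 2 * κ * ∫ p, F p := by
    change ∫ p : ℝ × ℝ, _ ∂(volume.prod volume) ≤ 2 * κ * ∫ p, F p ∂(volume.prod volume)
    rw [integral_prod _ iL, integral_prod _ hFi, ← integral_const_mul]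
    refine integral_mono_ae iL.integral_prod_left (hFi.integral_prod_left.const_mul _) ?_
    filter_upwards [hFi.prod_right_ae] with x hx
    have hux : ContDiff ℝ 2 fun v => w (x, v) := hw.comp (contDiff_prodMk_right x)
    have hslice := integral_cutoff_levyFP_le hs0 hs1 hM hMB hux (hwL x) (by
      have : levyFP s (fun v => w (x, v)) = fun v => T (x, v) + ε * v * D (x, v) :=
        funext (heq' x)
      rw [this]; fun_prop) hx hβ
    simp only [heq'] at hslice
    have e : ∫ v, α x * β v * (2 * (w (x, v) / M v) * (T (x, v) + ε * v * D (x, v)))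
        = α x * ∫ v, β v * (2 * (w (x, v) / M v) * (T (x, v) + ε * v * D (x, v))) := by
      rw [← integral_const_mul]; congr 1; ext v; ring
    rw [e]
    have hI : 0 ≤ 2 * κ * ∫ v, F (x, v) :=
      mul_nonneg (by positivity) (integral_nonneg fun v => hF0 _)
    calc _ ≤ α x * (2 * κ * ∫ v, F (x, v)) := mul_le_mul_of_nonneg_left hslice (hα.nonneg x)
      _ ≤ _ := mul_le_of_le_one_left hI (hα.le_one x)
  -- the transport term
  have ciF : ∀ g : ℝ × ℝ → ℝ, Continuous g →
      Integrable (fun p : ℝ × ℝ => deriv α p.1 * β p.2 * g p) (volume.prod volume) := fun g hg =>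
    (by fun_prop : Continuous fun p : ℝ × ℝ =>
      deriv α p.1 * β p.2 * g p).integrable_of_hasCompactSupport hsupp'.mul_right
  have iA := ciF (fun p => ε * p.2 * F p) (by fun_prop)
  have h2 : (∫ p : ℝ × ℝ, α p.1 * β p.2 * (2 * (w p / M p.2) * (ε * p.2 * D p)))
      + ∫ p : ℝ × ℝ, deriv α p.1 * β p.2 * (ε * p.2 * F p) = 0 := by
    change (∫ p : ℝ × ℝ, _ ∂(volume.prod volume)) + ∫ p : ℝ × ℝ, _ ∂(volume.prod volume) = 0
    rw [← integral_add iD iA, integral_prod_symm (fun p : ℝ × ℝ =>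
      α p.1 * β p.2 * (2 * (w p / M p.2) * (ε * p.2 * D p))
        + deriv α p.1 * β p.2 * (ε * p.2 * F p)) (iD.add iA)]
    refine integral_eq_zero_of_ae (.of_forall fun v => ?_)
    have hα1 : ContDiff ℝ 1 α := hα.contDiff.of_le (by norm_num)
    have hFv : ContDiff ℝ 1 fun y => F (y, v) := hFc.comp (contDiff_prodMk_left v)
    have hz := integral_deriv_eq_zero_of_hasCompactSupport (hα1.mul hFv)
      (hα.hasCompactSupport.mul_right)
    have hder : ∀ x, deriv (fun y => α y * F (y, v)) x
        = deriv α x * F (x, v) + α x * (2 * w (x, v) * D (x, v) / M v) := fun x => by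
      have hd := (hα1.differentiable (by norm_num) x).hasDerivAt.mul
        (((hdx x v).pow 2).div_const (M v))
      have hd' : deriv (fun y => α y * F (y, v)) x = _ := hd.deriv
      rw [hd']
      simp [hFdef, hD]
    have hz' : ∫ x, deriv (fun y => α y * F (y, v)) x = 0 := hz
    simp only [hder] at hz'
    have e : ∫ x, (α x * β v * (2 * (w (x, v) / M v) * (ε * v * D (x, v)))
        + deriv α x * β v * (ε * v * F (x, v)))
        = (β v * (ε * v)) * ∫ x, (deriv α x * F (x, v) + α x * (2 * w (x, v) * D (x, v) / M v)) := by
      rw [← integral_const_mul]; congr 1; ext x; ring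
    simp only [Pi.zero_apply]
    rw [e, hz', mul_zero]
  have h3 : |∫ p : ℝ × ℝ, deriv α p.1 * β p.2 * (ε * p.2 * F p)| ≤ ε * κ * ∫ p, F p := by
    rw [← Real.norm_eq_abs, ← integral_const_mul]
    refine norm_integral_le_of_norm_le (hF.const_mul _) (.of_forall fun p => ?_)
    have hb : |deriv α p.1| * (|β p.2| * |p.2|) ≤ κ := by
      by_cases hp : β p.2 = 0
      · simpa [hp] using hκ
      · have hβ1 : |β p.2| ≤ 1 := by rw [abs_of_nonneg (hβ.nonneg _)]; exact hβ.le_one _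
        calc _ ≤ κ' * (1 * V) := by
              gcongr
              · exact hα.abs_deriv_le _
              · exact hV _ hp
          _ ≤ κ := by linarith
    rw [Real.norm_eq_abs]
    have e : |deriv α p.1 * β p.2 * (ε * p.2 * F p)|
        = ε * (|deriv α p.1| * (|β p.2| * |p.2|)) * F p := by
      rw [abs_mul, abs_mul, abs_mul, abs_mul, abs_of_pos hε, abs_of_nonneg (hF0 p)]; ring
    rw [e]
    exact mul_le_mul_of_nonneg_right (mul_le_mul_of_nonneg_left hb hε.le) (hF0 p)
  have h4 : ∫ p : ℝ × ℝ, α p.1 * β p.2 * (2 * (w p / M p.2) * (T p + ε * p.2 * D p))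
      = (∫ p : ℝ × ℝ, α p.1 * β p.2 * (2 * (w p / M p.2) * T p))
        + ∫ p : ℝ × ℝ, α p.1 * β p.2 * (2 * (w p / M p.2) * (ε * p.2 * D p)) := by
    change ∫ p : ℝ × ℝ, _ ∂(volume.prod volume) = (∫ p : ℝ × ℝ, _ ∂(volume.prod volume))
      + ∫ p : ℝ × ℝ, _ ∂(volume.prod volume)
    rw [← integral_add iT iD]
    congr 1; ext p; ring
  have h5 := (abs_le.1 h3).2
  linarith

/-! ### The energy as a norm -/

theorem integrable_phaseMeasure_iff {M : ℝ → ℝ} (hM : Continuous M) (hpos : ∀ v, 0 < M v)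
    {g : ℝ × ℝ → ℝ} :
    Integrable g (phaseMeasure M) ↔ Integrable fun p : ℝ × ℝ => g p / M p.2 := by
  have hm : Measurable fun p : ℝ × ℝ => Real.toNNReal (M p.2)⁻¹ :=
    (hM.measurable.comp measurable_snd).inv.real_toNNReal
  have h := integrable_withDensity_iff_integrable_smul (μ := (volume : Measure (ℝ × ℝ))) hm
    (g := g)
  refine h.trans (integrable_congr (.of_forall fun p => ?_))
  simp only [NNReal.smul_def, smul_eq_mul]
  rw [Real.coe_toNNReal _ (inv_nonneg.2 (hpos _).le), div_eq_inv_mul]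

theorem integral_phaseMeasure {M : ℝ → ℝ} (hM : Continuous M) (hpos : ∀ v, 0 < M v)
    (g : ℝ × ℝ → ℝ) :
    ∫ p, g p ∂phaseMeasure M = ∫ p : ℝ × ℝ, g p / M p.2 := by
  have hm : Measurable fun p : ℝ × ℝ => Real.toNNReal (M p.2)⁻¹ :=
    (hM.measurable.comp measurable_snd).inv.real_toNNReal
  have h := integral_withDensity_eq_integral_smul (μ := (volume : Measure (ℝ × ℝ))) hm g
  refine h.trans (integral_congr_ae (.of_forall fun p => ?_))
  simp only [NNReal.smul_def, smul_eq_mul]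
  rw [Real.coe_toNNReal _ (inv_nonneg.2 (hpos _).le), div_eq_inv_mul]

theorem integrable_sq_div_of_memLp {M : ℝ → ℝ} (hM : Continuous M) (hpos : ∀ v, 0 < M v)
    {w : ℝ × ℝ → ℝ} (hw : MemLp w 2 (phaseMeasure M)) :
    Integrable fun p : ℝ × ℝ => w p ^ 2 / M p.2 :=
  (integrable_phaseMeasure_iff hM hpos).1 hw.integrable_sq

theorem toReal_eLpNorm_phaseMeasure_sq {M : ℝ → ℝ} (hM : Continuous M) (hpos : ∀ v, 0 < M v)
    {w : ℝ × ℝ → ℝ} (hw : MemLp w 2 (phaseMeasure M)) :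
    (eLpNorm w 2 (phaseMeasure M)).toReal ^ 2 = ∫ p : ℝ × ℝ, w p ^ 2 / M p.2 := by
  rw [toReal_eLpNorm_two_sq hw, integral_phaseMeasure hM hpos]

theorem energy_eq_toReal_eLpNorm {M : ℝ → ℝ} (hM : Continuous M) (hpos : ∀ v, 0 < M v)
    {f : ℝ → ℝ → ℝ → ℝ} {t : ℝ}
    (hf : MemLp (fun p : ℝ × ℝ => f t p.1 p.2) 2 (phaseMeasure M)) :
    energy M f t = (eLpNorm (fun p : ℝ × ℝ => f t p.1 p.2) 2 (phaseMeasure M)).toReal := by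
  have hi : Integrable (fun p : ℝ × ℝ => f t p.1 p.2 ^ 2 / M p.2) (volume.prod volume) :=
    integrable_sq_div_of_memLp hM hpos hf
  have h := toReal_eLpNorm_phaseMeasure_sq hM hpos hf
  have h2 := integral_prod _ hi
  rw [energy, ← h2]
  change √(∫ p : ℝ × ℝ, f t p.1 p.2 ^ 2 / M p.2) = _
  rw [← h, Real.sqrt_sq ENNReal.toReal_nonneg]

theorem IsEquilibrium.exists_le {s : ℝ} (hs0 : 0 < s) {M : ℝ → ℝ} (hM : IsEquilibrium s M) :
    ∃ B, ∀ v, M v ≤ B := by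
  obtain ⟨C, hC, ht⟩ := hM.tail
  have h := ht.eventually_le_const (lt_add_one C)
  rw [← Metric.cobounded_eq_cocompact] at h
  have h2 := h.and (tendsto_norm_cobounded_atTop.eventually_ge_atTop (1 : ℝ))
  rw [Metric.cobounded_eq_cocompact, Filter.Eventually, mem_cocompact] at h2
  obtain ⟨K, hK, hKs⟩ := h2
  obtain ⟨B, hB⟩ := hK.exists_bound_of_continuousOn hM.contDiff.continuous.continuousOn
  refine ⟨max B (C + 1), fun v => ?_⟩
  by_cases hv : v ∈ K
  · exact (le_abs_self _).trans ((hB v hv).trans (le_max_left _ _))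
  · obtain ⟨h1, h2⟩ := hKs hv
    refine le_trans ?_ (le_max_right _ _)
    refine le_trans ?_ h1
    exact le_mul_of_one_le_right (hM.pos v).le (Real.one_le_rpow h2 (by linarith))

/-- The energy of a solution does not grow between positive times: test with `α n (x) β n (v)`, where
`β n` is chosen first and `α n` is slow relative to the support of `β n`. -/
theorem IsLFPSolution.integral_le {s ε : ℝ} (hs0 : 0 < s) (hs1 : s < 1) (hε : 0 < ε) {M : ℝ → ℝ}
    (hM : IsEquilibrium s M) {f_in : ℝ → ℝ → ℝ} {f : ℝ → ℝ → ℝ → ℝ}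
    (hf : IsLFPSolution s ε M f_in f) {a b : ℝ} (ha : 0 < a) (hab : a ≤ b) :
    ∫ p : ℝ × ℝ, f b p.1 p.2 ^ 2 / M p.2 ≤ ∫ p : ℝ × ℝ, f a p.1 p.2 ^ 2 / M p.2 := by
  obtain ⟨B, hMB⟩ := hM.exists_le hs0
  have hMc := hM.contDiff.continuous
  have hreg := hf.regular
  have hpos : ∀ t ∈ Icc a b, 0 < t := fun t ht => ha.trans_le ht.1
  have hε' : 0 < ε ^ (2 * s) := by positivity
  choose β hβ using fun n : ℕ => exists_isCutoff (κ := 1 / ((n : ℝ) + 1)) hs0 hs1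
    Nat.one_div_pos_of_nat
  have hV : ∀ n : ℕ, ∃ V : ℝ, 0 ≤ V ∧ ∀ v, β n v ≠ 0 → |v| ≤ V := fun n => by
    obtain ⟨K, hK⟩ := (hβ n).hasCompactSupport.isBounded.exists_norm_le
    exact ⟨max K 0, le_max_right _ _,
      fun v hv => (hK v (subset_tsupport _ hv)).trans (le_max_left _ _)⟩
  choose V hV0 hV using hV
  have hκ' : ∀ n : ℕ, 0 < 1 / ((n : ℝ) + 1) / (1 + V n) := fun n => by
    have := hV0 n; positivity
  choose α hα using fun n : ℕ => exists_isCutoff hs0 hs1 (hκ' n)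
  have hsupp : ∀ n, HasCompactSupport fun p : ℝ × ℝ => α n p.1 * β n p.2 := fun n => by
    refine HasCompactSupport.of_support_subset_isCompact
      ((hα n).hasCompactSupport.isCompact.prod (hβ n).hasCompactSupport.isCompact) fun p hp => ?_
    have hp' : α n p.1 * β n p.2 ≠ 0 := hp
    exact ⟨subset_tsupport _ (left_ne_zero_of_mul hp'), subset_tsupport _ (right_ne_zero_of_mul hp')⟩
  have hφc : ∀ n, Continuous fun p : ℝ × ℝ => α n p.1 * β n p.2 := fun n => by
    have h1 := (hα n).contDiff.continuous
    have h2 := (hβ n).contDiff.continuous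
    fun_prop
  obtain ⟨K, hK⟩ := (isCompact_Icc (a := a) (b := b)).exists_bound_of_continuousOn
    ((hreg.curve.continuousOn_eLpNorm.mono fun t ht => (hpos t ht).le).pow 2)
  refine integral_le_of_tested_deriv_le (μ := volume) (K := K)
    (F := fun t (p : ℝ × ℝ) => f t p.1 p.2 ^ 2 / M p.2)
    (φ := fun n p => α n p.1 * β n p.2)
    (J' := fun n t => ∫ p : ℝ × ℝ, α n p.1 * β n p.2 *
      (2 * (f t p.1 p.2 / M p.2) * deriv (fun r => f r p.1 p.2) t))
    (c := fun n : ℕ => (2 + ε) / ε ^ (2 * s) * (1 / ((n : ℝ) + 1))) hab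
    (fun t p => div_nonneg (sq_nonneg _) (hM.pos _).le)
    (fun t ht => integrable_sq_div_of_memLp hMc hM.pos (hreg.curve.memLp t (hpos t ht).le))
    (fun t ht => ?_) (fun n => (hφc n).aestronglyMeasurable)
    (fun n p => mul_nonneg ((hα n).nonneg _) ((hβ n).nonneg _))
    (fun n p => mul_le_one₀ ((hα n).le_one _) ((hβ n).nonneg _) ((hβ n).le_one _))
    (fun p => ?_) (fun n t ht => ?_) (fun n => by positivity) ?_ (fun n t ht => ?_)
  · rw [← toReal_eLpNorm_phaseMeasure_sq hMc hM.pos (hreg.curve.memLp t (hpos t ht).le)]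
    exact (le_abs_self _).trans (hK t ht)
  · have h1 := tendsto_one_of_isCutoff hα hκ' (fun n => div_le_self (by positivity)
      (by linarith [hV0 n])) p.1
    have h2 := tendsto_one_of_isCutoff hβ (fun n => Nat.one_div_pos_of_nat) (fun n => le_rfl) p.2
    simpa using h1.mul h2
  · exact hasDerivAt_integral_mul_sq_div (U := fun q : ℝ × ℝ × ℝ => f q.1 q.2.1 q.2.2)
      hreg.contDiffOn (m := fun p : ℝ × ℝ => M p.2) (by fun_prop) (fun p => (hM.pos _).ne')
      (hφc n) (hsupp n) (hpos t ht)
  · simpa using (tendsto_one_div_add_atTop_nhds_zero_nat (𝕜 := ℝ)).const_mul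
      ((2 + ε) / ε ^ (2 * s))
  · have ht0 := hpos t ht
    have hTc : Continuous fun p : ℝ × ℝ => deriv (fun r => f r p.1 p.2) t :=
      (continuousOn_deriv_time hreg.contDiffOn).comp_continuous
        (f := fun p : ℝ × ℝ => (t, p)) (by fun_prop) fun p => ⟨ht0, mem_univ _⟩
    have h := integral_phase_cutoff_le hs0 hs1 hε hM hMB (hreg.contDiff t ht0)
      (hreg.fracLap_exists t ht0)
      (T := fun p => ε ^ (2 * s) * deriv (fun r => f r p.1 p.2) t) (by fun_prop)
      (hf.equation t ht0)
      (integrable_sq_div_of_memLp hMc hM.pos (hreg.curve.memLp t ht0.le)) (hα n) (hβ n)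
      (by positivity) (hV n) (by
        have := hV0 n
        rw [div_mul_eq_mul_div, div_le_iff₀ (by positivity)]
        have h1 : (0 : ℝ) ≤ 1 / ((n : ℝ) + 1) := by positivity
        nlinarith) (hκ' n).le
    have e : ∫ p : ℝ × ℝ, α n p.1 * β n p.2 * (2 * (f t p.1 p.2 / M p.2) *
        (ε ^ (2 * s) * deriv (fun r => f r p.1 p.2) t))
        = ε ^ (2 * s) * ∫ p : ℝ × ℝ, α n p.1 * β n p.2 * (2 * (f t p.1 p.2 / M p.2) *
        deriv (fun r => f r p.1 p.2) t) := by
      rw [← integral_const_mul]; congr 1; ext p; ring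
    rw [e] at h
    have e2 : (2 + ε) / ε ^ (2 * s) * (1 / ((n : ℝ) + 1)) * ∫ p : ℝ × ℝ, f t p.1 p.2 ^ 2 / M p.2
        = ((2 + ε) * (1 / ((n : ℝ) + 1)) * ∫ p : ℝ × ℝ, f t p.1 p.2 ^ 2 / M p.2)
          / ε ^ (2 * s) := by ring
    rw [e2, le_div_iff₀ hε']
    linarith

/-! ### Differentiability of the energy -/

/-- The norm of a differentiable Hilbert-space curve is differentiable, even where the curve
vanishes, provided that it is non-increasing: the curve then stays at zero, so its derivative
is zero there. -/
theorem differentiableAt_norm_of_antitoneOn {H : Type*} [NormedAddCommGroup H]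
    [InnerProductSpace ℝ H] {U : ℝ → H} {W : H} {a t : ℝ} (hat : a < t) (hU : HasDerivAt U W t)
    (hanti : AntitoneOn (fun r => ‖U r‖) (Ici a)) : DifferentiableAt ℝ (fun r => ‖U r‖) t := by
  by_cases h0 : U t = 0
  · have hz : ∀ r, t ≤ r → U r = 0 := fun r hr => by
      have := hanti hat.le (hat.le.trans hr) hr
      simp only [h0, norm_zero] at this
      exact norm_le_zero_iff.1 this
    have hW : W = 0 := by
      have h1 : HasDerivWithinAt U W (Ici t) t := hU.hasDerivWithinAt
      have h2 : HasDerivWithinAt U 0 (Ici t) t :=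
        (hasDerivWithinAt_const t (Ici t) (0 : H)).congr (fun r hr => hz r hr) h0
      exact (uniqueDiffWithinAt_Ici t).eq_deriv _ h1 h2
    rw [hW, hasDerivAt_iff_isLittleO] at hU
    refine HasDerivAt.differentiableAt (f' := 0) ?_
    rw [hasDerivAt_iff_isLittleO]
    simpa [h0] using hU.norm_left
  · exact hU.differentiableAt.norm ℝ h0

/-- Differentiability in `L²`, phrased with functions, lifts to the Hilbert space `Lp ℝ 2 μ`. -/
theorem exists_hasDerivAt_of_l2DifferentiableAt {α : Type*} [MeasurableSpace α] {μ : Measure α}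
    {u : ℝ → α → ℝ} {t : ℝ} (ht : 0 < t) (hu : ∀ r, 0 ≤ r → MemLp (u r) 2 μ)
    (h : L2DifferentiableAt μ u t) :
    ∃ (U : ℝ → Lp ℝ 2 μ) (W : Lp ℝ 2 μ), HasDerivAt U W t ∧
      ∀ r, 0 ≤ r → ‖U r‖ = (eLpNorm (u r) 2 μ).toReal := by
  classical
  obtain ⟨w, hw, hlim⟩ := h
  let U : ℝ → Lp ℝ 2 μ := fun r => if hr : MemLp (u r) 2 μ then hr.toLp (u r) else 0
  have hU : ∀ r (hr : 0 ≤ r), U r = (hu r hr).toLp (u r) := fun r hr => dif_pos (hu r hr)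
  refine ⟨U, hw.toLp w, ?_, fun r hr => by rw [hU r hr, Lp.norm_toLp]⟩
  rw [hasDerivAt_iff_tendsto_slope, tendsto_iff_norm_sub_tendsto_zero]
  refine ((ENNReal.tendsto_toReal ENNReal.zero_ne_top).comp hlim).congr' ?_
  filter_upwards [nhdsWithin_le_nhds (lt_mem_nhds ht)] with r hr
  have e : slope U t r - hw.toLp w
      = ((((hu r hr.le).sub (hu t ht.le)).const_smul (r - t)⁻¹).sub hw).toLp
        ((r - t)⁻¹ • (u r - u t) - w) := by
    rw [slope_def_module, hU r hr.le, hU t ht.le]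
    rfl
  rw [e, Lp.norm_toLp]
  simp only [Function.comp]
  congr 2
  ext p
  simp [div_eq_inv_mul]

/-- Monotonicity at positive times extends to `t = 0` by continuity in `L²`; differentiability at
almost every time is Lebesgue's theorem on monotone functions. -/
theorem IsLFPSolution.energyDissipates {s ε : ℝ} (hs0 : 0 < s) (hs1 : s < 1) (hε : 0 < ε)
    {M : ℝ → ℝ} (hM : IsEquilibrium s M) {f_in : ℝ → ℝ → ℝ} {f : ℝ → ℝ → ℝ → ℝ}
    (hf : IsLFPSolution s ε M f_in f) : EnergyDissipates M f := by
  have hMc := hM.contDiff.continuous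
  have hcurve := hf.regular.curve
  have hE : ∀ t, 0 ≤ t → energy M f t
      = (eLpNorm (fun p : ℝ × ℝ => f t p.1 p.2) 2 (phaseMeasure M)).toReal := fun t ht =>
    energy_eq_toReal_eLpNorm hMc hM.pos (hcurve.memLp t ht)
  have hanti : AntitoneOn (energy M f) (Ici 0) := by
    refine antitoneOn_Ici_of_Ioi (hcurve.continuousOn_eLpNorm.congr fun t ht => hE t ht)
      fun a b ha hab => ?_
    have h := hf.integral_le hs0 hs1 hε hM ha hab
    have hb : 0 ≤ b := ha.le.trans hab
    rw [← toReal_eLpNorm_phaseMeasure_sq hMc hM.pos (hcurve.memLp b hb),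
      ← toReal_eLpNorm_phaseMeasure_sq hMc hM.pos (hcurve.memLp a ha.le)] at h
    rw [hE b hb, hE a ha.le]
    exact (sq_le_sq₀ ENNReal.toReal_nonneg ENNReal.toReal_nonneg).1 h
  have hderiv : ∀ t, 0 < t → deriv (energy M f) t ≤ 0 := fun t ht => by
    rw [← derivWithin_of_mem_nhds (Ici_mem_nhds ht)]
    exact hanti.derivWithin_nonpos
  refine ⟨hanti, ?_, fun t ht h => ⟨?_, hderiv t ht⟩⟩
  · filter_upwards [hanti.neg.ae_differentiableWithinAt_of_mem] with t h ht
    have h1 := (h (mem_Ici.2 ht.le)).differentiableAt (Ici_mem_nhds ht)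
    exact ⟨differentiableAt_neg_iff.1 h1, hderiv t ht⟩
  · obtain ⟨U, W, hUW, hUn⟩ := exists_hasDerivAt_of_l2DifferentiableAt ht hcurve.memLp h
    have hEU : ∀ r, 0 ≤ r → energy M f r = ‖U r‖ := fun r hr => by rw [hE r hr, hUn r hr]
    have hd := differentiableAt_norm_of_antitoneOn ht hUW
      (hanti.congr fun r hr => hEU r hr)
    refine hd.congr_of_eventuallyEq ?_
    filter_upwards [lt_mem_nhds ht] with r hr using hEU r hr.le

/-! ### Calculus of the fractional Laplacian -/

theorem cutKernel_mul {s δ a : ℝ} (ha : 0 < a) (z : ℝ) :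
    cutKernel s δ z = a ^ (1 + 2 * s) * cutKernel s (a * δ) (a * z) := by
  simp only [cutKernel, indicator, mem_ofPred_eq, abs_mul, abs_of_pos ha]
  have h : (a * δ < a * |z|) ↔ δ < |z| := mul_lt_mul_iff_of_pos_left ha
  simp only [h]
  split_ifs
  · rw [Real.mul_rpow ha.le (abs_nonneg z), mul_inv, ← mul_assoc, mul_inv_cancel₀ (by positivity),
      one_mul]
  · simp

/-- The fractional Laplacian under an affine change of variables. -/
theorem HasFracLap.comp_affine {s a b x L : ℝ} {u : ℝ → ℝ} (ha : 0 < a)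
    (h : HasFracLap s u (b + a * x) L) :
    HasFracLap s (fun y => u (b + a * y)) x (a ^ (2 * s) * L) := by
  have hk : ∀ δ y, (u (b + a * x) - u (b + a * y)) * cutKernel s δ (x - y)
      = a ^ (1 + 2 * s) * ((fun z => (u (b + a * x) - u (b + z)) *
        cutKernel s (a * δ) (b + a * x - (b + z))) (a * y)) := fun δ y => by
    beta_reduce
    rw [cutKernel_mul ha, show b + a * x - (b + a * y) = a * (x - y) by ring]
    ring
  refine ⟨fun δ hδ => ?_, ?_⟩
  · have h1 := integrableOn_fracKernel_iff.1 (h.1 (a * δ) (by positivity))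
    rw [integrableOn_fracKernel_iff]
    simp only [hk]
    exact ((h1.comp_add_left b).comp_mul_left' ha.ne').const_mul _
  · have e : ∀ δ, truncFracLap s (fun y => u (b + a * y)) x δ
        = a ^ (2 * s) * truncFracLap s u (b + a * x) (a * δ) := fun δ => by
      rw [truncFracLap_eq, truncFracLap_eq]
      simp only [hk]
      rw [integral_const_mul, Measure.integral_comp_mul_left (fun z => (u (b + a * x) - u (b + z)) *
          cutKernel s (a * δ) (b + a * x - (b + z))) a, abs_of_pos (inv_pos.2 ha),
        integral_add_left_eq_self (fun z => (u (b + a * x) - u z) *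
          cutKernel s (a * δ) (b + a * x - z)) b, smul_eq_mul, Real.rpow_add ha, Real.rpow_one]
      field_simp
    have ht : Tendsto (fun δ => a * δ) (𝓝[>] 0) (𝓝[>] 0) := by
      refine tendsto_nhdsWithin_iff.2 ⟨?_, ?_⟩
      · have : Tendsto (fun δ => a * δ) (𝓝 0) (𝓝 (a * 0)) := tendsto_id.const_mul a
        rw [mul_zero] at this
        exact this.mono_left nhdsWithin_le_nhds
      · filter_upwards [self_mem_nhdsWithin] with δ hδ
        exact mul_pos ha hδ
    exact ((h.2.comp ht).const_mul (a ^ (2 * s))).congr fun δ => (e δ).symm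

theorem HasFracLap.comp_add_const {s b x L : ℝ} {u : ℝ → ℝ} (h : HasFracLap s u (x + b) L) :
    HasFracLap s (fun y => u (y + b)) x L := by
  have h1 : HasFracLap s u (b + 1 * x) L := by rwa [one_mul, add_comm]
  simpa [add_comm] using h1.comp_affine one_pos

theorem HasFracLap.add {s x L₁ L₂ : ℝ} {u w : ℝ → ℝ} (hu : HasFracLap s u x L₁)
    (hw : HasFracLap s w x L₂) : HasFracLap s (fun y => u y + w y) x (L₁ + L₂) := by
  have hk : fracKernel s (fun y => u y + w y) x = fun y => fracKernel s u x y + fracKernel s w x y := by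
    ext y; simp only [fracKernel]; ring
  refine ⟨fun δ hδ => by rw [hk]; exact (hu.1 δ hδ).add (hw.1 δ hδ), ?_⟩
  refine (hu.2.add hw.2).congr' ?_
  filter_upwards [self_mem_nhdsWithin] with δ hδ
  rw [truncFracLap, truncFracLap, truncFracLap, hk, ← mul_add, integral_add (hu.1 δ hδ) (hw.1 δ hδ)]

theorem HasFracLap.const_mul {s x L : ℝ} {u : ℝ → ℝ} (c : ℝ) (hu : HasFracLap s u x L) :
    HasFracLap s (fun y => c * u y) x (c * L) := by
  have hk : fracKernel s (fun y => c * u y) x = fun y => c * fracKernel s u x y := by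
    ext y; simp only [fracKernel]; ring
  refine ⟨fun δ hδ => by rw [hk]; exact (hu.1 δ hδ).const_mul c, ?_⟩
  refine (hu.2.const_mul c).congr fun δ => ?_
  rw [truncFracLap, truncFracLap, hk, integral_const_mul]; ring

theorem HasFracLap.sub {s x L₁ L₂ : ℝ} {u w : ℝ → ℝ} (hu : HasFracLap s u x L₁)
    (hw : HasFracLap s w x L₂) : HasFracLap s (fun y => u y - w y) x (L₁ - L₂) := by
  simpa [sub_eq_add_neg] using hu.add (hw.const_mul (-1))

/-- The integral defining the remainder `I(a,b)(v)` converges absolutely. -/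
theorem integrable_prodRem {s B v : ℝ} (hs1 : s < 1) {a b : ℝ → ℝ} (ha : ContDiff ℝ 1 a)
    (hb : ContDiff ℝ 1 b) (hB : ∀ w, |b w| ≤ B)
    (hfar : IntegrableOn (fracKernel s a v) {y : ℝ | 1 < |v - y|}) :
    Integrable fun w => (a v - a w) * (b w - b v) / |v - w| ^ (1 + 2 * s) := by
  have lip : ∀ g : ℝ → ℝ, ContDiff ℝ 1 g → ∃ D, 0 ≤ D ∧ ∀ w, |v - w| ≤ 1 →
      |g v - g w| ≤ D * |v - w| := by
    intro g hg
    obtain ⟨D, hD⟩ := (isCompact_closedBall v 1).exists_bound_of_continuousOn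
      (hg.continuous_deriv le_rfl).continuousOn
    refine ⟨D, (norm_nonneg _).trans (hD v (by simp)), fun w hw => ?_⟩
    exact (convex_closedBall v 1).norm_image_sub_le_of_norm_deriv_le
      (fun x _ => hg.differentiable (by norm_num) x) hD (x := w) (y := v)
      (by rwa [Metric.mem_closedBall, dist_comm, Real.dist_eq]) (by simp)
  obtain ⟨D, hD0, hD⟩ := lip a ha
  obtain ⟨D', hD'0, hD'⟩ := lip b hb
  have i1 := ((integrable_abs_rpow_near (p := 1 - 2 * s) (by linarith)).comp_sub_left v).const_mul
    (D * D')
  have i2 := (integrableOn_fracKernel_iff.1 hfar).abs.const_mul (2 * B)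
  have hca := ha.continuous
  have hcb := hb.continuous
  have hm : Measurable fun w => (a v - a w) * (b w - b v) / |v - w| ^ (1 + 2 * s) := by
    fun_prop
  refine (i1.add i2).mono' hm.aestronglyMeasurable ?_
  filter_upwards [compl_mem_ae_iff.2 (measure_singleton v)] with w hw
  have hw0 : 0 < |v - w| := abs_pos.2 (sub_ne_zero.2 (Ne.symm hw))
  simp only [Pi.add_apply, indicator, cutKernel, mem_ofPred_eq]
  rw [Real.norm_eq_abs, abs_div, abs_mul, abs_of_nonneg (a := |v - w| ^ (1 + 2 * s)) (by positivity)]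
  by_cases h : |v - w| ≤ 1
  · simp only [h, not_lt.2 h, if_true, if_false, mul_zero, abs_zero, add_zero]
    rw [div_le_iff₀ (by positivity), mul_assoc, ← Real.rpow_add hw0]
    have e : 1 - 2 * s + (1 + 2 * s) = 2 := by ring
    rw [e, Real.rpow_two, abs_sub_comm (b w)]
    calc _ ≤ (D * |v - w|) * (D' * |v - w|) :=
          mul_le_mul (hD w h) (hD' w h) (abs_nonneg _) (by positivity)
      _ = _ := by ring
  · simp only [h, not_le.1 h, if_true, if_false, mul_zero, zero_add]
    rw [abs_mul, abs_inv, abs_of_nonneg (a := |v - w| ^ (1 + 2 * s)) (by positivity), div_eq_mul_inv,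
      ← mul_assoc (2 * B)]
    refine mul_le_mul_of_nonneg_right ?_ (by positivity)
    rw [mul_comm]
    refine mul_le_mul_of_nonneg_right ?_ (abs_nonneg _)
    linarith [abs_sub (b w) (b v), hB w, hB v]

/-- The product rule `(-Δ)^s (a b) = a (-Δ)^s b + b (-Δ)^s a + I(a,b)`. -/
theorem HasFracLap.mul {s v La Lb : ℝ} {a b : ℝ → ℝ} (ha : HasFracLap s a v La)
    (hb : HasFracLap s b v Lb)
    (hR : Integrable fun w => (a v - a w) * (b w - b v) / |v - w| ^ (1 + 2 * s)) :
    HasFracLap s (fun w => a w * b w) v (a v * Lb + b v * La + prodRem s a b v) := by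
  set R : ℝ → ℝ := fun w => (a v - a w) * (b w - b v) / |v - w| ^ (1 + 2 * s) with hRdef
  have hk : fracKernel s (fun w => a w * b w) v
      = fun w => a v * fracKernel s b v w + b v * fracKernel s a v w + R w := by
    ext w; simp only [fracKernel, hRdef]; ring
  have i1 : ∀ δ, 0 < δ → IntegrableOn (fun w => a v * fracKernel s b v w) {y | δ < |v - y|} :=
    fun δ hδ => (hb.1 δ hδ).const_mul _
  have i2 : ∀ δ, 0 < δ → IntegrableOn (fun w => b v * fracKernel s a v w) {y | δ < |v - y|} :=
    fun δ hδ => (ha.1 δ hδ).const_mul _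
  have i12 : ∀ δ, 0 < δ → IntegrableOn (fun w => a v * fracKernel s b v w
      + b v * fracKernel s a v w) {y | δ < |v - y|} := fun δ hδ => (i1 δ hδ).add (i2 δ hδ)
  have hlim : Tendsto (fun δ => ∫ w in {y : ℝ | δ < |v - y|}, R w) (𝓝[>] 0) (𝓝 (∫ w, R w)) := by
    simp only [← integral_indicator (measurableSet_far v _)]
    refine tendsto_integral_filter_of_dominated_convergence (fun w => ‖R w‖) ?_ ?_ hR.norm ?_
    · exact .of_forall fun δ => hR.1.indicator (measurableSet_far v δ)
    · exact .of_forall fun δ => .of_forall fun w => norm_indicator_le_norm_self _ _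
    · refine .of_forall fun w => tendsto_const_nhds.congr' ?_
      by_cases hw : v = w
      · refine .of_forall fun δ => ?_
        have : R w = 0 := by simp [hRdef, hw]
        simp [indicator, this]
      · have hw0 : 0 < |v - w| := abs_pos.2 (sub_ne_zero.2 hw)
        filter_upwards [Ioo_mem_nhdsGT hw0] with δ hδ
        exact (indicator_of_mem (s := {y : ℝ | δ < |v - y|}) hδ.2 R).symm
  refine ⟨fun δ hδ => by rw [hk]; exact (i12 δ hδ).add hR.integrableOn, ?_⟩
  refine (((hb.2.const_mul (a v)).add (ha.2.const_mul (b v))).add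
    (hlim.const_mul (fracConst s))).congr' ?_
  filter_upwards [self_mem_nhdsWithin] with δ hδ
  rw [truncFracLap, truncFracLap, truncFracLap, hk,
    integral_add (i12 δ hδ) hR.integrableOn, integral_add (i1 δ hδ) (i2 δ hδ),
    integral_const_mul, integral_const_mul]
  ring

/-! ### Sums and shears of curves in `L²` -/

theorem IsL2Curve.add {α : Type*} [MeasurableSpace α] {μ : Measure α} {u w : ℝ → α → ℝ}
    (hu : IsL2Curve μ u) (hw : IsL2Curve μ w) : IsL2Curve μ (fun t p => u t p + w t p) := by
  refine ⟨fun t ht => (hu.memLp t ht).add (hw.memLp t ht), fun t ht => ?_⟩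
  have h := (hu.continuous t ht).add (hw.continuous t ht)
  rw [add_zero] at h
  refine tendsto_of_tendsto_of_tendsto_of_le_of_le' tendsto_const_nhds h
    (.of_forall fun _ => zero_le) ?_
  filter_upwards [self_mem_nhdsWithin] with r hr
  have e : (fun p => u r p + w r p - (u t p + w t p))
      = (fun p => u r p - u t p) + fun p => w r p - w t p := by ext p; simp only [Pi.add_apply]; ring
  rw [e]
  exact eLpNorm_add_le ((hu.memLp r hr).sub (hu.memLp t ht)).1
    ((hw.memLp r hr).sub (hw.memLp t ht)).1 (by norm_num)

theorem IsL2Curve.neg {α : Type*} [MeasurableSpace α] {μ : Measure α} {u : ℝ → α → ℝ}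
    (hu : IsL2Curve μ u) : IsL2Curve μ (fun t p => -u t p) := by
  refine ⟨fun t ht => (hu.memLp t ht).neg, fun t ht => ?_⟩
  refine (hu.continuous t ht).congr fun r => ?_
  rw [← eLpNorm_neg]
  congr 1; ext p; simp only [Pi.neg_apply]; ring

theorem IsL2Curve.comp_measurePreserving {α β : Type*} [MeasurableSpace α] [MeasurableSpace β]
    {μ : Measure α} {ν : Measure β} {u : ℝ → β → ℝ} (hu : IsL2Curve ν u) {T : α → β}
    (hT : MeasurePreserving T μ ν) : IsL2Curve μ (fun t p => u t (T p)) := by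
  refine ⟨fun t ht => (hu.memLp t ht).comp_measurePreserving hT, fun t ht => ?_⟩
  refine (hu.continuous t ht).congr' ?_
  filter_upwards [self_mem_nhdsWithin] with r hr
  exact (eLpNorm_comp_measurePreserving ((hu.memLp r hr).sub (hu.memLp t ht)).1 hT).symm

theorem IsL2Curve.congr {α : Type*} [MeasurableSpace α] {μ : Measure α} {u w : ℝ → α → ℝ}
    (hu : IsL2Curve μ u) (h : ∀ t, 0 ≤ t → u t = w t) : IsL2Curve μ w := by
  refine ⟨fun t ht => h t ht ▸ hu.memLp t ht, fun t ht => ?_⟩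
  refine (hu.continuous t ht).congr' ?_
  filter_upwards [self_mem_nhdsWithin] with r hr
  rw [h t ht, h r hr]

theorem quasiMeasurePreserving_add_mul (ε : ℝ) :
    Measure.QuasiMeasurePreserving (fun p : ℝ × ℝ => p.1 + ε * p.2) := by
  have h1 : MeasurePreserving (fun p : ℝ × ℝ => (p.1, p.2 + ε * p.1))
      (volume.prod volume) (volume.prod volume) :=
    (MeasurePreserving.id volume).skew_product (g := fun v x => x + ε * v) (by fun_prop)
      (.of_forall fun v => (measurePreserving_add_right volume (ε * v)).map_eq)
  have h2 : MeasurePreserving (Prod.swap : ℝ × ℝ → ℝ × ℝ) (volume.prod volume)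
      (volume.prod volume) := Measure.measurePreserving_swap
  exact Measure.quasiMeasurePreserving_snd.comp (h1.comp h2).quasiMeasurePreserving

/-- Sheared macroscopic profiles `z(x + ε v) M(v)` embed isometrically from `L²(dx)` into the
weighted phase space, since `M` has mass one. -/
theorem eLpNorm_shear_mul {s : ℝ} {M : ℝ → ℝ} (hM : IsEquilibrium s M) (ε : ℝ) {z : ℝ → ℝ}
    (hz : AEStronglyMeasurable z) :
    AEStronglyMeasurable (fun p : ℝ × ℝ => z (p.1 + ε * p.2) * M p.2) (phaseMeasure M) ∧
    eLpNorm (fun p : ℝ × ℝ => z (p.1 + ε * p.2) * M p.2) 2 (phaseMeasure M)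
      = eLpNorm z 2 volume := by
  have hMc := hM.contDiff.continuous
  have hzs : AEStronglyMeasurable fun p : ℝ × ℝ => z (p.1 + ε * p.2) :=
    hz.comp_quasiMeasurePreserving (quasiMeasurePreserving_add_mul ε)
  have hm : AEStronglyMeasurable fun p : ℝ × ℝ => z (p.1 + ε * p.2) * M p.2 :=
    hzs.mul (by fun_prop : Continuous fun p : ℝ × ℝ => M p.2).aestronglyMeasurable
  refine ⟨hm.mono_ac (withDensity_absolutelyContinuous _ _), ?_⟩
  rw [eLpNorm_eq_lintegral_rpow_enorm_toReal (by norm_num) (by norm_num),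
    eLpNorm_eq_lintegral_rpow_enorm_toReal (by norm_num) (by norm_num)]
  congr 1
  simp only [ENNReal.toReal_ofNat, ENNReal.rpow_ofNat]
  have hd : Measurable fun p : ℝ × ℝ => ENNReal.ofReal (M p.2)⁻¹ :=
    (hMc.measurable.comp measurable_snd).inv.ennreal_ofReal
  rw [phaseMeasure, lintegral_withDensity_eq_lintegral_mul₀ hd.aemeasurable (hm.enorm.pow_const 2)]
  have e : ∀ p : ℝ × ℝ, ((fun p : ℝ × ℝ => ENNReal.ofReal (M p.2)⁻¹) *
      fun p : ℝ × ℝ => ‖z (p.1 + ε * p.2) * M p.2‖ₑ ^ 2) p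
      = ENNReal.ofReal (M p.2) * ‖z (p.1 + ε * p.2)‖ₑ ^ 2 := fun p => by
    have h0 := hM.pos p.2
    simp only [Pi.mul_apply]
    rw [enorm_mul, mul_pow, Real.enorm_eq_ofReal h0.le, mul_left_comm, mul_comm,
      ← ENNReal.ofReal_pow h0.le, ← ENNReal.ofReal_mul (inv_nonneg.2 h0.le)]
    congr 2
    field_simp
  simp only [e]
  have hdM : Measurable fun p : ℝ × ℝ => ENNReal.ofReal (M p.2) :=
    (hMc.measurable.comp measurable_snd).ennreal_ofReal
  change ∫⁻ p : ℝ × ℝ, _ ∂(volume.prod volume) = _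
  rw [lintegral_prod_symm (fun p : ℝ × ℝ => ENNReal.ofReal (M p.2) * ‖z (p.1 + ε * p.2)‖ₑ ^ 2)
    (hdM.aemeasurable.mul (hzs.enorm.pow_const 2))]
  have e2 : ∀ v : ℝ, ∫⁻ x, ENNReal.ofReal (M v) * ‖z (x + ε * v)‖ₑ ^ 2
      = ENNReal.ofReal (M v) * ∫⁻ x, ‖z x‖ₑ ^ 2 := fun v => by
    rw [lintegral_const_mul' _ _ ENNReal.ofReal_ne_top,
      lintegral_add_right_eq_self (fun x => ‖z x‖ₑ ^ 2) (ε * v)]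
  simp only [e2]
  rw [lintegral_mul_const _ hMc.measurable.ennreal_ofReal,
    ← ofReal_integral_eq_lintegral_ofReal hM.integrable (.of_forall fun v => (hM.pos v).le),
    hM.integral_eq_one, ENNReal.ofReal_one, one_mul]

theorem IsL2Curve.shear_mul {s : ℝ} {M : ℝ → ℝ} (hM : IsEquilibrium s M) (ε : ℝ) {ρ : ℝ → ℝ → ℝ}
    (hρ : IsL2Curve volume ρ) :
    IsL2Curve (phaseMeasure M) (fun t (p : ℝ × ℝ) => ρ t (p.1 + ε * p.2) * M p.2) := by
  refine ⟨fun t ht => ?_, fun t ht => ?_⟩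
  · have h := eLpNorm_shear_mul hM ε (hρ.memLp t ht).1
    exact ⟨h.1, h.2 ▸ (hρ.memLp t ht).2⟩
  · refine (hρ.continuous t ht).congr' ?_
    filter_upwards [self_mem_nhdsWithin] with r hr
    have h := (eLpNorm_shear_mul hM ε ((hρ.memLp r hr).sub (hρ.memLp t ht)).1).2
    simp only [Pi.sub_apply, sub_mul] at h
    exact h.symm

/-! ### From the split system to the kinetic equation -/

/-- The velocity enters the equation for `η` only as a parameter, so uniqueness for the fractional
heat equation propagates the shear structure `η(t,x,v) = η(t,x+εv,0)` of the initial data. -/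
theorem IsSplitSolution.eta_eq_shear {s ε : ℝ} (hs0 : 0 < s) (hs1 : s < 1) {M : ℝ → ℝ}
    {f_in : ℝ → ℝ → ℝ} {η g : ℝ → ℝ → ℝ → ℝ} (h : IsSplitSolution s ε M f_in η g) {t : ℝ}
    (ht : 0 ≤ t) (x v : ℝ) : η t x v = η t (x + ε * v) 0 := by
  rcases ht.eq_or_lt with rfl | ht0
  · rw [h.η_initial, h.η_initial]; simp
  have hL : ∀ t, 0 < t → ∀ x, HasFracLap s (fun x => η t x v - η t (x + ε * v) 0) x
      (fracLap s (fun y => η t y v) x - fracLap s (fun y => η t y 0) (x + ε * v)) := fun t ht x =>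
    (h.η_fracLap_exists t ht x v).hasFracLap.sub
      (h.η_fracLap_exists t ht (x + ε * v) 0).hasFracLap.comp_add_const
  have hd : ∀ v t, 0 < t → ∀ x, HasDerivAt (fun r => η r x v) (deriv (fun r => η r x v) t) t :=
    fun v t ht x => (hasDerivAt_of_contDiffOn_time (h.η_contDiffOn v) ht
      x).differentiableAt.hasDerivAt
  have hz := eq_zero_of_fractional_heat hs0 hs1
    (u := fun t x => η t x v - η t (x + ε * v) 0) ?_ ?_ ?_ ?_ ?_ ?_ ht0 x
  · exact sub_eq_zero.1 hz
  · have h2 := ((h.η_curve 0).comp_measurePreserving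
      (measurePreserving_add_right volume (ε * v))).neg
    exact ((h.η_curve v).add h2).congr fun t _ => by ext x; ring
  · refine (h.η_contDiffOn v).sub ((h.η_contDiffOn 0).comp
      (g := fun q : ℝ × ℝ => η q.1 q.2 0) (f := fun q : ℝ × ℝ => (q.1, q.2 + ε * v))
      (by fun_prop) fun q hq => ⟨hq.1, mem_univ _⟩)
  · intro t ht
    exact (h.η_contDiff t ht v).sub ((h.η_contDiff t ht 0).comp (by fun_prop))
  · exact fun t ht x => ⟨_, hL t ht x⟩
  · intro t ht x
    have e : deriv (fun r => η r x v - η r (x + ε * v) 0) t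
        = deriv (fun r => η r x v) t - deriv (fun r => η r (x + ε * v) 0) t :=
      ((hd v t ht x).sub (hd 0 t ht (x + ε * v))).deriv
    rw [(hL t ht x).fracLap_eq, e, h.η_equation t ht, h.η_equation t ht]
    ring
  · intro x
    rw [h.η_initial, h.η_initial]; simp

/-- The sum `η M + g` of a solution of the split system solves the kinetic equation. -/
theorem IsSplitSolution.isLFPSolution {s ε : ℝ} (hs0 : 0 < s) (hs1 : s < 1) (hε : 0 < ε)
    {M : ℝ → ℝ} (hM : IsEquilibrium s M) {f_in : ℝ → ℝ → ℝ} {η g : ℝ → ℝ → ℝ → ℝ}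
    (h : IsSplitSolution s ε M f_in η g) :
    IsLFPSolution s ε M f_in (fun t x v => η t x v * M v + g t x v) := by
  obtain ⟨B, hMB⟩ := hM.exists_le hs0
  have hshear := fun {t : ℝ} (ht : 0 ≤ t) => h.eta_eq_shear hs0 hs1 ht
  have hM1 : ContDiff ℝ 1 M := hM.contDiff.of_le (by norm_num)
  have hsx : ∀ t, 0 < t → ∀ x, (fun w => η t x w) = fun w => η t (x + ε * w) 0 :=
    fun t ht x => funext fun w => hshear ht.le x w
  have hsv : ∀ t, 0 < t → ∀ v, (fun y => η t y v) = fun y => η t (y + ε * v) 0 :=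
    fun t ht v => funext fun y => hshear ht.le y v
  have hρ : ∀ t, 0 < t → ContDiff ℝ 2 fun y => η t y 0 := fun t ht => h.η_contDiff t ht 0
  have hηv : ∀ t, 0 < t → ∀ x, ContDiff ℝ 1 fun w => η t x w := fun t ht x => by
    rw [hsx t ht x]
    exact ((hρ t ht).comp (by fun_prop : ContDiff ℝ 2 fun w : ℝ => x + ε * w)).of_le (by norm_num)
  -- the fractional Laplacian of `η` in velocity, by scaling
  have hηL : ∀ t, 0 < t → ∀ x v, HasFracLap s (fun w => η t x w) v
      (ε ^ (2 * s) * fracLap s (fun y => η t y 0) (x + ε * v)) := fun t ht x v => by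
    rw [hsx t ht x]
    exact (h.η_fracLap_exists t ht (x + ε * v) 0).hasFracLap.comp_affine hε
  have hprod : ∀ t, 0 < t → ∀ x v, HasFracLap s (fun w => η t x w * M w) v
      (η t x v * fracLap s M v
        + M v * (ε ^ (2 * s) * fracLap s (fun y => η t y 0) (x + ε * v))
        + prodRem s (fun w => η t x w) M v) := fun t ht x v =>
    (hηL t ht x v).mul (hM.fracLap_exists v).hasFracLap
      (integrable_prodRem hs1 (hηv t ht x) hM1
        (fun w => by rw [abs_of_pos (hM.pos w)]; exact hMB w) ((hηL t ht x v).1 1 one_pos))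
  have hsum : ∀ t, 0 < t → ∀ x v, HasFracLap s (fun w => η t x w * M w + g t x w) v
      (η t x v * fracLap s M v
        + M v * (ε ^ (2 * s) * fracLap s (fun y => η t y 0) (x + ε * v))
        + prodRem s (fun w => η t x w) M v + fracLap s (fun w => g t x w) v) := fun t ht x v =>
    (hprod t ht x v).add (h.g_regular.fracLap_exists t ht x v).hasFracLap
  refine ⟨⟨?_, ?_, ?_, fun t ht x v => ⟨_, hsum t ht x v⟩⟩, fun t ht x v => ?_, fun x v => ?_⟩
  · refine (((h.η_curve 0).shear_mul hM ε).add h.g_regular.curve).congr fun t ht => ?_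
    ext p
    rw [hshear ht p.1 p.2]
  · have h1 : ContDiffOn ℝ 1 (fun q : ℝ × ℝ × ℝ => η q.1 (q.2.1 + ε * q.2.2) 0) (Ioi 0 ×ˢ univ) :=
      (h.η_contDiffOn 0).comp (g := fun q : ℝ × ℝ => η q.1 q.2 0)
        (f := fun q : ℝ × ℝ × ℝ => (q.1, q.2.1 + ε * q.2.2)) (by fun_prop)
        fun q hq => ⟨hq.1, mem_univ _⟩
    have h2 : ContDiff ℝ 1 fun q : ℝ × ℝ × ℝ => M q.2.2 := hM1.comp (by fun_prop)
    refine ((h1.mul h2.contDiffOn).add h.g_regular.contDiffOn).congr fun q hq => ?_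
    have hq0 : 0 < q.1 := hq.1
    rw [hshear hq0.le q.2.1 q.2.2]
  · intro t ht
    have h1 : ContDiff ℝ 2 fun p : ℝ × ℝ => η t (p.1 + ε * p.2) 0 := (hρ t ht).comp (by fun_prop)
    have h2 : ContDiff ℝ 2 fun p : ℝ × ℝ => M p.2 := hM.contDiff.comp (by fun_prop)
    have h3 := (h1.mul h2).add (h.g_regular.contDiff t ht)
    have e : (fun p : ℝ × ℝ => η t p.1 p.2 * M p.2 + g t p.1 p.2)
        = fun p : ℝ × ℝ => η t (p.1 + ε * p.2) 0 * M p.2 + g t p.1 p.2 :=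
      funext fun p => by rw [hshear ht.le p.1 p.2]
    rw [e]
    exact h3
  · -- all derivatives of `η` are expressed through `ρ = η(t, ·, 0)` at the point `x + ε v`
    set D := deriv (fun y => η t y 0) (x + ε * v) with hD
    have dρ : HasDerivAt (fun y => η t y 0) D (x + ε * v) :=
      ((hρ t ht).differentiable (by norm_num) _).hasDerivAt
    have dηx : HasDerivAt (fun y => η t y v) D x := by
      rw [hsv t ht v]
      exact dρ.comp_add_const x (ε * v)
    have dηv : HasDerivAt (fun w => η t x w) (D * ε) v := by
      rw [hsx t ht x]
      have ha : HasDerivAt (fun w : ℝ => x + ε * w) ε v := by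
        simpa using ((hasDerivAt_id v).const_mul ε).const_add x
      exact dρ.comp v ha
    have dηt : HasDerivAt (fun r => η r x v) (-fracLap s (fun y => η t y 0) (x + ε * v)) t := by
      have h1 := (hasDerivAt_of_contDiffOn_time (h.η_contDiffOn v) ht
        x).differentiableAt.hasDerivAt
      have h2 : HasFracLap s (fun y => η t y v) x (fracLap s (fun y => η t y 0) (x + ε * v)) := by
        rw [hsv t ht v]
        exact (h.η_fracLap_exists t ht (x + ε * v) 0).hasFracLap.comp_add_const
      have h3 := h.η_equation t ht x v
      rw [h2.fracLap_eq] at h3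
      rw [← h3]
      exact h1
    have dgt : DifferentiableAt ℝ (fun r => g r x v) t :=
      (hasDerivAt_of_contDiffOn_time (U := fun q : ℝ × ℝ × ℝ => g q.1 q.2.1 q.2.2)
        h.g_regular.contDiffOn ht (x, v)).differentiableAt
    have hg := (h.g_regular.contDiff t ht).differentiable (by norm_num)
    have dgx : DifferentiableAt ℝ (fun y => g t y v) x :=
      (hg (x, v)).comp x (f := fun y : ℝ => (y, v)) (by fun_prop)
    have dgv : DifferentiableAt ℝ (fun w => g t x w) v :=
      (hg (x, v)).comp v (f := fun w : ℝ => (x, w)) (by fun_prop)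
    have dM : HasDerivAt M (deriv M v) v := (hM1.differentiable (by norm_num) v).hasDerivAt
    have e1 : deriv (fun r => η r x v * M v + g r x v) t
        = -fracLap s (fun y => η t y 0) (x + ε * v) * M v + deriv (fun r => g r x v) t :=
      ((dηt.mul_const (M v)).add dgt.hasDerivAt).deriv
    have e2 : deriv (fun y => η t y v * M v + g t y v) x
        = D * M v + deriv (fun y => g t y v) x :=
      ((dηx.mul_const (M v)).add dgx.hasDerivAt).deriv
    have e3 : deriv (fun w => w * (η t x w * M w + g t x w)) v
        = 1 * (η t x v * M v + g t x v)
          + v * ((D * ε * M v + η t x v * deriv M v) + deriv (fun w => g t x w) v) :=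
      ((hasDerivAt_id v).mul ((dηv.mul dM).add dgv.hasDerivAt)).deriv
    have e4 : deriv (fun w => w * g t x w) v = 1 * g t x v + v * deriv (fun w => g t x w) v :=
      ((hasDerivAt_id v).mul dgv.hasDerivAt).deriv
    have hgeq := h.g_equation t ht x v
    rw [levyFP, e4] at hgeq
    rw [levyFP, (hsum t ht x v).fracLap_eq, e1, e2, e3, hM.fracLap_eq]
    linear_combination hgeq
  · rw [h.g_initial]; ring

end LFP

theorem proposition3p2 (s ε : ℝ) (hs0 : 0 < s) (hs1 : s < 1) (hε : 0 < ε)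
    (M : ℝ → ℝ) (hM : LFP.IsEquilibrium s M) (f_in : ℝ → ℝ → ℝ) :
    (∀ η g : ℝ → ℝ → ℝ → ℝ, LFP.IsSplitSolution s ε M f_in η g →
      LFP.IsLFPSolution s ε M f_in (fun t x v => η t x v * M v + g t x v)) ∧
    (∀ f : ℝ → ℝ → ℝ → ℝ, LFP.IsLFPSolution s ε M f_in f → LFP.EnergyDissipates M f) ∧
    (∀ η g : ℝ → ℝ → ℝ → ℝ, LFP.IsSplitSolution s ε M f_in η g →
      LFP.EnergyDissipates M (fun t x v => η t x v * M v + g t x v)) :=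
  ⟨fun _ _ h => h.isLFPSolution hs0 hs1 hε hM,
    fun _ h => h.energyDissipates hs0 hs1 hε hM,
    fun _ _ h => (h.isLFPSolution hs0 hs1 hε hM).energyDissipates hs0 hs1 hε hM⟩
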